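/- **Setting.** Contexts take values in $\mathcal S$, actions in $\mathcal A$, rewards in $\mathbb R$. A policy $\pi$ assigns to each $s\in\mathcal S$ a probability density $\pi(\cdot\mid s)$ on $\mathcal A$ with respect to a fixed $\sigma$-finite reference measure. Let $P_S$ be a context distribution, $P_R(\cdot\mid s,a)$ a conditional reward distribution, $\pi_b$ the behavior policy and $\pi_e$ the target policy. The data $\mathcal D=\{(S_i,A_i,R_i)\}_{i=1}^n$ are i.i.d. with $S_i\sim P_S$, $A_i\sim\pi_b(\cdot\mid S_i)$, $R_i\sim P_R(\cdot\mid S_i,A_i)$. The variables $V_1,\dots,V_n$ are i.i.d. uniform on $[0,1]$ and independent of $\mathcal D$. The test point $(S_{n+1},A_{n+1},R_{n+1})$ is independent of $(\mathcal D,V)$, with $S_{n+1}\sim P_S$, $A_{n+1}\sim\pi_e(\cdot\mid S_{n+1})$, $R_{n+1}\sim P_R(\cdot\mid S_{n+1},A_{n+1})$. **Algorithm.** Let $\epsilon,\delta,\gamma\in(0,1)$, let $\epsilon_{\rm lo},\epsilon_{\rm up}$ be quantile levels with $\epsilon_{\rm up}-\epsilon_{\rm lo}=1-\epsilon$, and let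 a policy estimation algorithm and an arbitrary (measurable, deterministic) quantile estimation algorithm be given. 1. Split $\mathcal D=\mathcal D_1\cup\mathcal D_2$ by a fixed split of the indices with $|\mathcal D_2|=\lceil\gamma n\rceil$, so $|\mathcal D_1|=\lfloor(1-\gamma)n\rfloor$. 2. Compute an estimate $\hat\pi_b$ of $\pi_b$ from $\mathcal D_1$, and put $\hat w(s,a)=\pi_e(a\mid s)/\hat\pi_b(a\mid s)$ (with $0/0=0$) and $\hat B=\sup_{s,a}\hat w(s,a)$. 3. For $j=1,2$ let $\mathcal D_j^{\rm rs}$ consist of the pairs $(S_i,R_i)$ with $(S_i,A_i,R_i)\in\mathcal D_j$ and $V_i\le\hat w(S_i,A_i)/\hat B$, in order of the index. 4. Apply the quantile algorithm to $\mathcal D_1^{\rm rs}$ at the levels $\epsilon_{\rm lo},\epsilon_{\rm up}$ to get functions $\hat q_{\rm lo},\hat q_{\rm up}:\mathcal S\to\mathbb R$. 5. Let $M=|\mathcal D_2^{\rm rs}|$, let $\tau_{(1)}\le\dots\le\tau_{(M)}$ be the ordered values of $\max\{\hat q_{\rm lo}(S_i)-R_i,\;R_i-\hat q_{\rm up}(S_i)\}$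 over $(S_i,R_i)\in\mathcal D_2^{\rm rs}$, and $\tau_{(M+1)}=\infty$. Let $k$ be the largest element of $\{-1,0,\dots,M-1\}$ with $F_{\mathrm{Bin}(M,\epsilon)}(k)\le\delta$, and $\tilde\tau=\tau_{(M-k)}$. 6. Output $\hat C_{\tilde\tau}(s)=[\hat q_{\rm lo}(s)-\tilde\tau,\ \hat q_{\rm up}(s)+\tilde\tau]$. Let $L=\mathbb P[R_{n+1}\notin\hat C_{\tilde\tau}(S_{n+1})\mid\mathcal D,V]$ be the miscoverage probability given the data, including the auxiliary uniform variables $V=(V_1,\dots,V_n)$. **Theorem.** Let $\Pi$ be a finite class of policies with $\pi_b\in\Pi$ and $\sup_{s,a}\frac{\pi_e(a\mid s)}{\pi(a\mid s)}\le B_\Pi<\infty$ for all $\pi\in\Pi$ (with $0/0=0$ and $c/0=\infty$ for $c>0$). Let $n$ be such that $\lfloor(1-\gamma)n\rfloor\ge1$. If the behavior policy is estimated by maximum likelihood, $$\hat\pi_b\in\arg\max_{\pi\in\Pi}\sum_{(S_i,A_i,R_i)\in\mathcal D_1}\log\pi(A_i\mid S_i)$$ (with $\log 0=-\infty$ and ties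 broken by any measurable rule), then for every $\delta_0\in(0,1)$ $$\mathbb P\left[L\le\epsilon+2B_\Pi\sqrt{\frac{2\log(|\Pi|/\delta_0)}{\lfloor(1-\gamma)n\rfloor}}\,\right]\ge(1-\delta_0)(1-\delta).$$ -/

import Mathlib

open MeasureTheory ProbabilityTheory
open scoped ENNReal NNReal

namespace PACOPP

noncomputable section

/-- A (stochastic) policy `π : S → Δ(A)`, given by its conditional densities `π(a | s)` with respect
to a reference measure `ν` on the action space (for instance Lebesgue measure for continuous
actions, counting measure for discrete ones). -/
@[ext] structure Policy (S A : Type*) [MeasurableSpace S] [MeasurableSpace A]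
    (ν : Measure A) where
  /-- The density `π(a | s)`. -/
  dens : S → A → ℝ≥0
  measurable_dens : Measurable (fun p : S × A => dens p.1 p.2)
  lintegral_dens : ∀ s, ∫⁻ a, (dens s a : ℝ≥0∞) ∂ν = 1

/-- An observation `(context, action, reward)`, bracketed as `((s, a), r)`. -/
abbrev Obs (S A : Type*) := (S × A) × ℝ

section Model

variable {S A : Type*} [MeasurableSpace S] [MeasurableSpace A] {ν : Measure A}

/-- The Markov kernel `s ↦ π(a | s) ν(da)` of a policy. -/
def Policy.kernel [SFinite ν] (π : Policy S A ν) : Kernel S A :=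
  (Kernel.const S ν).withDensity (fun s a => (π.dens s a : ℝ≥0∞))

/-- The law of `(S, A, R)` when `S ∼ P_S`, `A ∼ π(· | S)` given `S` and `R ∼ P_R(· | S, A)` given
`(S, A)`. -/
def banditLaw [SFinite ν] (PS : Measure S) (π : Policy S A ν) (PR : Kernel (S × A) ℝ) :
    Measure (Obs S A) :=
  (PS ⊗ₘ π.kernel) ⊗ₘ PR

/-- The ratio `(π_e / π)(a | s)` in `[0, ∞]`, with `0 / 0 = 0` and `c / 0 = ∞` for `c > 0`. -/
def ratio (πe π : Policy S A ν) (s : S) (a : A) : ℝ≥0∞ :=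
  (πe.dens s a : ℝ≥0∞) / (π.dens s a : ℝ≥0∞)

/-- The log-likelihood `∑ log π(A_i | S_i)` of a policy, with `log 0 = -∞`. -/
def logLik {I : Type*} [Fintype I] (π : Policy S A ν) (d : I → Obs S A) : EReal :=
  ∑ i, ENNReal.log (π.dens (d i).1.1 (d i).1.2 : ℝ≥0∞)

/-- `est` is a maximum likelihood estimator over the finite class `Pol`: for every data set it
returns a maximizer of the log-likelihood, ties being broken in any measurable way. -/
structure IsMLE {I : Type*} [Fintype I] (Pol : Finset (Policy S A ν))
    (est : (I → Obs S A) → Policy S A ν) : Prop where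
  mem : ∀ d, est d ∈ Pol
  max : ∀ d, ∀ π ∈ Pol, logLik π d ≤ logLik (est d) d
  measurable : ∀ π ∈ Pol, MeasurableSet {d | est d = π}

end Model

section RejectionSampling

variable {S A : Type*} {n : ℕ}

open Classical in
/-- The indices `i ∈ J` of the observations that rejection sampling keeps, that is those with
`V_i ≤ w(S_i, A_i) / B`, where `B` is the supremum of `w` over all contexts and actions. -/
def accepted (w : S → A → ℝ≥0∞) (J : Finset (Fin n)) (x : Fin n → Obs S A) (v : Fin n → ℝ) :
    Finset (Fin n) :=
  J.filter fun i => ENNReal.ofReal (v i) ≤ w (x i).1.1 (x i).1.2 / ⨆ (s : S) (a : A), w s a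

/-- The pairs `(S_i, R_i)` for `i ∈ I`, in ascending order of the index `i`. -/
def pairs (I : Finset (Fin n)) (x : Fin n → Obs S A) : Fin I.card → S × ℝ :=
  fun j => ((x (I.orderEmbOfFin rfl j)).1.1, (x (I.orderEmbOfFin rfl j)).2)

end RejectionSampling

section Calibration

/-- The cumulative distribution function of the binomial distribution `Bin(m, p)` at `k`. -/
def binCdf (m : ℕ) (p : ℝ) (k : ℤ) : ℝ :=
  ∑ i ∈ (Finset.range (m + 1)).filter (fun i : ℕ => (i : ℤ) ≤ k),
    (m.choose i : ℝ) * p ^ i * (1 - p) ^ (m - i)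

/-- `k(m, ε, δ)`, the largest `k ∈ {-1, 0, …, m - 1}` with `F_{Bin(m, ε)}(k) ≤ δ`. -/
def kIndex (m : ℕ) (ε δ : ℝ) : ℤ :=
  sSup {k : ℤ | -1 ≤ k ∧ k ≤ (m : ℤ) - 1 ∧ binCdf m ε k ≤ δ}

/-- The `j`-th smallest (`1 ≤ j ≤ m`) among `t₁, …, tₘ`; it is `∞` for `j = m + 1`. -/
def orderStat {m : ℕ} (t : Fin m → ℝ) (j : ℕ) : EReal :=
  if h : 1 ≤ j ∧ j ≤ m then ((t (Tuple.sort t ⟨j - 1, by omega⟩) : ℝ) : EReal) else ⊤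

variable {S : Type*}

/-- The non-conformity score of `(s, r)`. -/
def score (qlo qup : S → ℝ) (z : S × ℝ) : ℝ := max (qlo z.1 - z.2) (z.2 - qup z.1)

/-- The interval `C_τ(s) = [q_lo(s) - τ, q_up(s) + τ]`, which is `ℝ` for `τ = ∞`. -/
def interval (qlo qup : S → ℝ) (τ : EReal) (s : S) : Set ℝ :=
  {r | (qlo s : EReal) - τ ≤ (r : EReal) ∧ (r : EReal) ≤ (qup s : EReal) + τ}

/-- The PAC conformal calibration step on the calibration data `z₁, …, zₘ`. -/
def pacCP {m : ℕ} (z : Fin m → S × ℝ) (ε δ : ℝ) (qlo qup : S → ℝ) : S → Set ℝ :=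
  interval qlo qup (orderStat (fun i => score qlo qup (z i)) ((m : ℤ) - kIndex m ε δ).toNat)

/-- A quantile estimation algorithm: it maps a training set of any size `m`, a level `α` and a
context `s` to an estimate of the conditional `α`-quantile of the reward given `s`. -/
abbrev QuantileAlg (S : Type*) := (m : ℕ) → (Fin m → S × ℝ) → ℝ → S → ℝ

end Calibration

section Algorithm

variable {S A : Type*} [MeasurableSpace S] [MeasurableSpace A] {ν : Measure A} {n : ℕ}

/-- The prediction set `s ↦ Ĉ(s)` that PAC off-policy prediction with unknown behavior policy
computes from the data `x`, the uniform variables `v`, the policy estimation algorithm `est`, the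
quantile algorithm `qalg` and the quantile levels `εlo`, `εup`; here `J` indexes the second part of
the data and `Jᶜ` the first. -/
def pacopp (J : Finset (Fin n)) (πe : Policy S A ν)
    (est : (↥Jᶜ → Obs S A) → Policy S A ν) (qalg : QuantileAlg S) (ε δ εlo εup : ℝ)
    (x : Fin n → Obs S A) (v : Fin n → ℝ) : S → Set ℝ :=
  let w := ratio πe (est fun i => x i)
  let D₁ := pairs (accepted w Jᶜ x v) x
  let D₂ := pairs (accepted w J x v) x
  pacCP D₂ ε δ (qalg _ D₁ εlo) (qalg _ D₁ εup)

end Algorithm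

/-- The conditional probability, given the data, that the reward of the test point `T` lies outside
the prediction set at the context of `T`. -/
def miscoverage {Ω S A 𝒟 : Type*} [MeasurableSpace Ω] [MeasurableSpace 𝒟] (P : Measure Ω)
    (data : Ω → 𝒟) (T : Ω → Obs S A) (C : Ω → S → Set ℝ) : Ω → ℝ :=
  P⟦{ω | (T ω).2 ∉ C ω (T ω).1.1} | MeasurableSpace.comap data inferInstance⟧

end

end PACOPP

/-! Given the first part of the data, an accepted observation has density proportional to
$P_S\,\pi_b\,\hat w\,P_R$, while the target law is $P_S\,\hat\pi_b\,\hat w\,P_R$, because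
$\pi_e=\hat w\hat\pi_b$. The two laws differ only through the error of $\hat\pi_b$, so calibration
and estimation can be treated separately.

Estimation: the chance that a wrong policy is at least as likely as $\pi_b$ on $m$ observations is
bounded by Markov's inequality for $\prod\sqrt{\pi/\pi_b}$, whose mean is the $m$-th power of the
Bhattacharyya coefficient. An expected $L^1$ distance above $2\sqrt{2x}$ forces this coefficient
below $e^{-x}$. With $x=\log(|\Pi|/\delta_0)/m$ and a union bound over $\Pi$, the estimate is that
far off with probability at most $\delta_0$ (`measure_lt_policyDist_mle_le`).

Calibration: with the first part frozen the score is a fixed function. Let $q$ be its upper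
$\epsilon$-quantile under the accepted law. Miscoverage above $\epsilon$ requires that at most $k$
accepted scores reach $q$. Given the number of accepted points, that count is binomial with success
probability at least $\epsilon$, so this has probability at most $\delta$
(`measureReal_calibration_fails_le`).

Transfer: passing from the accepted law to the target law costs at most $B_\Pi$ times the $L^1$
distance (`banditLaw_real_le`).

Combination: the calibration bound holds for every value of the first part, so the two success
probabilities multiply (`mul_le_measure_of_iIndepFun`). Since the test point is independent of the
data, $L$ is the target mass of a section of the miss set (`condExp_indicator_eq_of_indepFun`). -/

namespace PACOPP

/-! ### Binomial distribution functions and sums over subsets. -/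

section Binomial

theorem binCdf_eq_antidiagonal (m : ℕ) (p : ℝ) (k : ℤ) :
    binCdf m p k = ∑ ij ∈ Finset.HasAntidiagonal.antidiagonal m,
      (m.choose ij.1 : ℝ) * (if (ij.1 : ℤ) ≤ k then p ^ ij.1 * (1 - p) ^ ij.2 else 0) := by
  rw [Finset.Nat.sum_antidiagonal_eq_sum_range_succ
    (f := fun i j => (m.choose i : ℝ) * (if (i : ℤ) ≤ k then p ^ i * (1 - p) ^ j else 0)),
    binCdf, Finset.sum_filter]
  refine Finset.sum_congr rfl fun i _ => ?_
  split_ifs <;> ring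

/-- Condition on one trial: a success lowers the remaining allowance to $k-1$, a failure leaves it
at $k$. -/
theorem binCdf_succ (m : ℕ) (p : ℝ) (k : ℤ) :
    binCdf (m + 1) p k = p * binCdf m p (k - 1) + (1 - p) * binCdf m p k := by
  simp only [binCdf_eq_antidiagonal]
  rw [Finset.sum_antidiagonal_choose_succ_mul
    (f := fun i j => (if (i : ℤ) ≤ k then p ^ i * (1 - p) ^ j else 0)), add_comm,
    Finset.mul_sum, Finset.mul_sum]
  congr 1
  · refine Finset.sum_congr rfl fun ij h => ?_
    have : m.choose ij.2 = m.choose ij.1 :=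
      Nat.choose_symm_of_eq_add (by rw [← Finset.HasAntidiagonal.mem_antidiagonal.1 h, add_comm])
    rw [this]
    have h2 : (((ij.1 + 1 : ℕ) : ℤ) ≤ k) = ((ij.1 : ℤ) ≤ k - 1) := by
      ext; push_cast; constructor <;> intro h <;> linarith
    simp only [h2]
    split_ifs <;> ring
  · refine Finset.sum_congr rfl fun ij h => ?_
    split_ifs <;> ring

theorem binCdf_mono_right {m : ℕ} {p : ℝ} (h0 : 0 ≤ p) (h1 : p ≤ 1) {k l : ℤ} (h : k ≤ l) :
    binCdf m p k ≤ binCdf m p l := by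
  refine Finset.sum_le_sum_of_subset_of_nonneg ?_ fun i _ _ => ?_
  · intro i; simp only [Finset.mem_filter]; exact fun hi => ⟨hi.1, hi.2.trans h⟩
  · have : 0 ≤ 1 - p := by linarith
    positivity

/-- With $\Delta=F_q-F_p$, subtracting the two recursions gives
$q\Delta(k-1)+(1-q)\Delta(k)+(p-q)(F_p(k)-F_p(k-1))$, a sum of nonnegative terms by induction. -/
theorem binCdf_anti {m : ℕ} {p q : ℝ} (hq0 : 0 ≤ q) (hqp : q ≤ p) (hp1 : p ≤ 1) (k : ℤ) :
    binCdf m p k ≤ binCdf m q k := by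
  induction m generalizing k with
  | zero => simp [binCdf_eq_antidiagonal]
  | succ m ih =>
    rw [binCdf_succ, binCdf_succ]
    have a := ih k
    have b := ih (k - 1)
    have c : binCdf m p (k - 1) ≤ binCdf m p k :=
      binCdf_mono_right (hq0.trans hqp) hp1 (by linarith)
    nlinarith [mul_nonneg (sub_nonneg.2 hqp) (sub_nonneg.2 c), mul_nonneg hq0 (sub_nonneg.2 b),
      mul_nonneg (sub_nonneg.2 (hqp.trans hp1)) (sub_nonneg.2 a)]

theorem kIndex_mem (m : ℕ) (ε : ℝ) {δ : ℝ} (hδ : 0 ≤ δ) :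
    -1 ≤ kIndex m ε δ ∧ kIndex m ε δ ≤ (m : ℤ) - 1 ∧ binCdf m ε (kIndex m ε δ) ≤ δ := by
  have : kIndex m ε δ ∈ {k : ℤ | -1 ≤ k ∧ k ≤ (m : ℤ) - 1 ∧ binCdf m ε k ≤ δ} := by
    -- The index $-1$ always qualifies because its sum is empty, so the supremum is attained.
    refine Int.csSup_mem ⟨-1, le_rfl, by omega, ?_⟩ ⟨(m : ℤ) - 1, fun k hk => hk.2.1⟩
    rw [binCdf, Finset.sum_eq_zero]
    · exact hδ
    · intro i hi
      have := (Finset.mem_filter.1 hi).2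
      omega
  exact this

theorem sum_powerset_filter_card {ι : Type*} (I : Finset ι) (a b s p : ℝ) (ha : a = s * p)
    (hb : b = s * (1 - p)) (k : ℤ) :
    ∑ H ∈ I.powerset with (H.card : ℤ) ≤ k, a ^ H.card * b ^ (I.card - H.card)
      = s ^ I.card * binCdf I.card p k := by
  rw [Finset.sum_filter, Finset.sum_powerset_apply_card
    (fun j => if (j : ℤ) ≤ k then a ^ j * b ^ (I.card - j) else 0), binCdf, Finset.sum_filter,
    Finset.mul_sum]
  refine Finset.sum_congr rfl fun i hi => ?_
  have hi : i ≤ I.card := by simpa [Nat.lt_succ_iff] using hi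
  subst ha hb
  split_ifs
  · rw [nsmul_eq_mul, mul_pow, mul_pow, ← Nat.add_sub_cancel' hi, pow_add]
    simp only [Nat.add_sub_cancel' hi]
    ring
  · simp

/-- Here $a$ and $b$ are the masses of accepted high and accepted low points, and $I$ is the
accepted set. Normalizing gives a binomial with $p=a/(a+b)\ge\epsilon$, and `binCdf_anti` reduces to
$p=\epsilon$, the parameter for which `kIndex` was chosen. -/
theorem sum_powerset_filter_card_le {ι : Type*} (I : Finset ι) {a b ε δ : ℝ} (ha : 0 ≤ a)
    (hb : 0 ≤ b) (hε0 : 0 ≤ ε) (hε1 : ε ≤ 1) (hδ : 0 ≤ δ) (h : ε * (a + b) ≤ a) :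
    ∑ H ∈ I.powerset with (H.card : ℤ) ≤ kIndex I.card ε δ, a ^ H.card * b ^ (I.card - H.card)
      ≤ (a + b) ^ I.card * δ := by
  obtain ⟨p, hp, hp1, h1, h2⟩ :
      ∃ p, ε ≤ p ∧ p ≤ 1 ∧ a = (a + b) * p ∧ b = (a + b) * (1 - p) := by
    rcases (add_nonneg ha hb).eq_or_lt with h0 | h0
    -- When $a+b=0$ the ratio is meaningless and any admissible $p$ serves.
    · exact ⟨ε, le_rfl, hε1, by rw [← h0]; linarith, by rw [← h0]; linarith⟩
    · refine ⟨a / (a + b), (le_div_iff₀ h0).2 h, (div_le_one h0).2 (by linarith), ?_, ?_⟩ <;>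
        field_simp
      ring
  rw [sum_powerset_filter_card I a b (a + b) p h1 h2]
  exact mul_le_mul_of_nonneg_left
    ((binCdf_anti hε0 hp hp1 _).trans (kIndex_mem I.card ε hδ).2.2) (by positivity)

end Binomial

/-! ### Order statistics and membership in the prediction set as counting statements. -/

section OrderStat

theorem orderStat_lt_iff {m : ℕ} (t : Fin m → ℝ) {j : ℕ} (h1 : 1 ≤ j) (h2 : j ≤ m + 1) (s : ℝ) :
    orderStat t j < (s : EReal) ↔ j ≤ (Finset.univ.filter fun i => t i < s).card := by
  unfold orderStat
  split_ifs with h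
  · rw [EReal.coe_lt_coe_iff]
    have := Tuple.lt_card_lt_iff_apply_lt_of_monotone (f := t ∘ Tuple.sort t) (a := s)
      (j := ⟨j - 1, by omega⟩) (Tuple.monotone_sort t)
    have hc : (Finset.univ.filter fun i => (t ∘ Tuple.sort t) i < s).card
        = (Finset.univ.filter fun i => t i < s).card :=
      Finset.card_bij (fun i _ => Tuple.sort t i) (by simp) (by simp)
        (fun i hi => ⟨(Tuple.sort t).symm i, by simpa using hi, by simp⟩)
    rw [hc] at this
    refine this.symm.trans ?_
    simp only
    omega
  · have : (Finset.univ.filter fun i => t i < s).card ≤ m := by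
      simpa using Finset.card_le_univ (Finset.univ.filter fun i => t i < s)
    simp only [not_top_lt, false_iff, not_le]
    omega

/-- The rank $m-k$ lies in $1,\dots,m+1$, so the value ∞ occurs only for $k=-1$, where both sides
are false. Otherwise at least $m-k$ values lie below $s$ exactly when at most $k$ do not. -/
theorem orderStat_sub_lt_iff {m : ℕ} (t : Fin m → ℝ) {k : ℤ} (h1 : -1 ≤ k) (h2 : k ≤ (m : ℤ) - 1)
    (s : ℝ) :
    orderStat t ((m : ℤ) - k).toNat < (s : EReal) ↔
      ((Finset.univ.filter fun i => s ≤ t i).card : ℤ) ≤ k := by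
  rw [orderStat_lt_iff t (by omega) (by omega)]
  have := Finset.card_filter_add_card_filter_not (s := Finset.univ) (fun i => t i < s)
  simp only [not_lt, Finset.card_univ, Fintype.card_fin] at this
  omega

theorem orderStat_ne_bot {m : ℕ} (t : Fin m → ℝ) (j : ℕ) : orderStat t j ≠ ⊥ := by
  unfold orderStat
  split_ifs <;> simp

theorem notMem_interval_iff {S : Type*} (qlo qup : S → ℝ) {τ : EReal} (hτ : τ ≠ ⊥) (s : S)
    (r : ℝ) : r ∉ interval qlo qup τ s ↔ τ < (score qlo qup (s, r) : ℝ) := by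
  induction τ with
  | bot => exact absurd rfl hτ
  | top => simp [interval]
  | coe t =>
    simp only [interval, Set.mem_ofPred_eq, score]
    norm_cast
    rw [not_and_or, lt_max_iff, not_le, not_le]
    constructor <;> rintro (h | h)
    · left; linarith
    · right; linarith
    · left; linarith
    · right; linarith

theorem card_filter_pairs {S A : Type*} {n : ℕ} (I : Finset (Fin n)) (x : Fin n → Obs S A)
    (p : S × ℝ → Prop) [DecidablePred p] :
    (Finset.univ.filter fun j => p (pairs I x j)).card
      = (I.filter fun i => p ((x i).1.1, (x i).2)).card := by
  refine Finset.card_bij (fun j _ => I.orderEmbOfFin rfl j) ?_ ?_ ?_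
  · intro j hj
    have := (Finset.mem_filter.1 hj).2
    simpa [pairs] using this
  · intro a _ b _ h
    exact (I.orderEmbOfFin rfl).injective h
  · intro i hi
    rw [Finset.mem_filter] at hi
    have : i ∈ Set.range (I.orderEmbOfFin rfl) := by simpa using hi.1
    obtain ⟨j, rfl⟩ := this
    exact ⟨j, Finset.mem_filter.2 ⟨Finset.mem_univ _, hi.2⟩, rfl⟩

/-- A reward lies outside the calibrated set iff at most `k` calibration scores reach its score. -/
theorem notMem_pacCP_pairs_iff {S A : Type*} {n : ℕ} (I : Finset (Fin n)) (x : Fin n → Obs S A)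
    (ε : ℝ) {δ : ℝ} (hδ : 0 ≤ δ) (qlo qup : S → ℝ) (s : S) (r : ℝ) :
    r ∉ pacCP (pairs I x) ε δ qlo qup s ↔
      ((I.filter fun i => score qlo qup (s, r) ≤ score qlo qup ((x i).1.1, (x i).2)).card : ℤ)
        ≤ kIndex I.card ε δ := by
  rw [pacCP, notMem_interval_iff _ _ (orderStat_ne_bot _ _),
    orderStat_sub_lt_iff _ (kIndex_mem _ _ hδ).1 (kIndex_mem _ _ hδ).2.1,
    card_filter_pairs I x (fun z => score qlo qup (s, r) ≤ score qlo qup z)]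

end OrderStat

end PACOPP
namespace PACOPP

/-! ### Upper quantiles of finite measures on the line. -/

section Quantile

/-- A finite measure on `ℝ` has upper quantiles at all levels strictly between `0` and its total
mass. -/
theorem exists_upper_quantile (ρ : Measure ℝ) [IsFiniteMeasure ρ] {c : ℝ≥0∞} (hc : c ≠ 0)
    (hcu : c < ρ Set.univ) :
    ∃ q : ℝ, ρ (Set.Ioi q) ≤ c ∧ c ≤ ρ (Set.Ici q) := by
  set U : Set ℝ := {τ | c < ρ (Set.Ioi τ)} with hU
  have hne : U.Nonempty := by
    have h := tendsto_measure_iUnion_atTop (μ := ρ) (s := fun n : ℕ => Set.Ioi (-(n : ℝ)))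
      (fun a b hab => Set.Ioi_subset_Ioi (by simpa using hab))
    have hu : (⋃ n : ℕ, Set.Ioi (-(n : ℝ))) = Set.univ := by
      ext x
      simp only [Set.mem_iUnion, Set.mem_Ioi, Set.mem_univ, iff_true]
      obtain ⟨n, hn⟩ := exists_nat_gt (-x)
      exact ⟨n, by linarith⟩
    rw [hu] at h
    obtain ⟨n, hn⟩ := (h.eventually (lt_mem_nhds hcu)).exists
    exact ⟨_, hn⟩
  have hbdd : BddAbove U := by
    have h := tendsto_measure_iInter_atTop (μ := ρ) (s := fun n : ℕ => Set.Ioi (n : ℝ))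
      (fun n => measurableSet_Ioi.nullMeasurableSet)
      (fun a b hab => Set.Ioi_subset_Ioi (by simpa using hab)) ⟨0, measure_ne_top _ _⟩
    have hu : (⋂ n : ℕ, Set.Ioi (n : ℝ)) = ∅ := by
      ext x
      simp only [Set.mem_iInter, Set.mem_Ioi, Set.mem_empty_iff_false, iff_false, not_forall,
        not_lt]
      obtain ⟨n, hn⟩ := exists_nat_gt x
      exact ⟨n, hn.le⟩
    rw [hu, measure_empty] at h
    obtain ⟨n, hn⟩ := (h.eventually (gt_mem_nhds (pos_iff_ne_zero.2 hc))).exists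
    refine ⟨n, fun τ hτ => ?_⟩
    by_contra! hlt
    exact absurd (hτ.trans_le (measure_mono (Set.Ioi_subset_Ioi hlt.le))) hn.not_gt
  -- By continuity from below, $U$ has no largest element, so its supremum lies outside $U$; this
  -- gives the bound on the open half-line.
  have hopen : ∀ τ ∈ U, ∃ τ' ∈ U, τ < τ' := by
    intro τ hτ
    have h := tendsto_measure_iUnion_atTop (μ := ρ)
      (s := fun n : ℕ => Set.Ioi (τ + 1 / ((n : ℝ) + 1)))
      (fun a b hab => Set.Ioi_subset_Ioi (by
        have := Nat.one_div_le_one_div (α := ℝ) hab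
        linarith))
    have hu : (⋃ n : ℕ, Set.Ioi (τ + 1 / ((n : ℝ) + 1))) = Set.Ioi τ := by
      ext x
      simp only [Set.mem_iUnion, Set.mem_Ioi]
      constructor
      · rintro ⟨n, hn⟩
        have := Nat.one_div_pos_of_nat (α := ℝ) (n := n)
        linarith
      · intro hx
        obtain ⟨n, hn⟩ := exists_nat_one_div_lt (sub_pos.2 hx)
        exact ⟨n, by linarith⟩
    rw [hu] at h
    obtain ⟨n, hn⟩ := (h.eventually (lt_mem_nhds hτ)).exists
    have := Nat.one_div_pos_of_nat (α := ℝ) (n := n)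
    exact ⟨_, hn, by linarith⟩
  refine ⟨sSup U, ?_, ?_⟩
  · by_contra! hlt
    obtain ⟨τ', h1, h2⟩ := hopen _ hlt
    exact h2.not_ge (le_csSup hbdd h1)
  · have h := tendsto_measure_iInter_atTop (μ := ρ)
      (s := fun n : ℕ => Set.Ioi (sSup U - 1 / ((n : ℝ) + 1)))
      (fun n => measurableSet_Ioi.nullMeasurableSet)
      (fun a b hab => Set.Ioi_subset_Ioi (by
        have := Nat.one_div_le_one_div (α := ℝ) hab
        linarith)) ⟨0, measure_ne_top _ _⟩
    have hu : (⋂ n : ℕ, Set.Ioi (sSup U - 1 / ((n : ℝ) + 1))) = Set.Ici (sSup U) := by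
      ext x
      simp only [Set.mem_iInter, Set.mem_Ioi, Set.mem_Ici]
      constructor
      · intro hx
        by_contra! hlt
        obtain ⟨n, hn⟩ := exists_nat_one_div_lt (sub_pos.2 hlt)
        have := hx n
        linarith
      · intro hx n
        have := Nat.one_div_pos_of_nat (α := ℝ) (n := n)
        linarith
    rw [hu] at h
    refine ge_of_tendsto' h fun n => ?_
    have := Nat.one_div_pos_of_nat (α := ℝ) (n := n)
    obtain ⟨τ, hτ, hlt⟩ := exists_lt_of_lt_csSup hne (b := sSup U - 1 / ((n : ℝ) + 1))
      (by linarith)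
    exact (le_of_lt hτ).trans (measure_mono (Set.Ioi_subset_Ioi hlt.le))

end Quantile

/-! ### The binomial tail bound with a random number of accepted points. -/

section Counting

variable {Ω ι α : Type*} [MeasurableSpace Ω] [MeasurableSpace α]

open Classical in
/-- For i.i.d. points, the number of accepted points that are high is rarely as small as the
binomial index for the number of accepted points, when high points make up a fraction of at least
`ε` among the accepted ones. -/
theorem measureReal_card_high_le (P : Measure Ω) [IsProbabilityMeasure P] (J : Finset ι)
    {Z : ι → Ω → α} (hZ : ∀ i, Measurable (Z i)) (hind : iIndepFun Z P) {acc high : Set α}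
    (hacc : MeasurableSet acc) (hhigh : MeasurableSet high) {a b : ℝ}
    (ha : ∀ i, P.real (Z i ⁻¹' (acc ∩ high)) = a) (hb : ∀ i, P.real (Z i ⁻¹' (acc \ high)) = b)
    {ε δ : ℝ} (hε0 : 0 ≤ ε) (hε1 : ε ≤ 1) (hδ : 0 ≤ δ) (hab : ε * (a + b) ≤ a) :
    P.real {ω | ((J.filter fun i => Z i ω ∈ acc ∧ Z i ω ∈ high).card : ℤ)
      ≤ kIndex (J.filter fun i => Z i ω ∈ acc).card ε δ} ≤ δ := by
  -- With no points the index is $-1$ and the event is empty. Otherwise an index is at hand to show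
  -- $a,b\ge0$.
  rcases J.eq_empty_or_nonempty with rfl | ⟨i₀, hi₀⟩
  · have : kIndex 0 ε δ ≤ -1 := (kIndex_mem 0 ε hδ).2.1
    have h : ¬ (0 ≤ kIndex 0 ε δ) := by omega
    simp [h, hδ]
  have ha0 : 0 ≤ a := ha i₀ ▸ measureReal_nonneg
  have hb0 : 0 ≤ b := hb i₀ ▸ measureReal_nonneg
  have hr : ∀ i, P.real (Z i ⁻¹' accᶜ) = 1 - (a + b) := by
    intro i
    rw [Set.preimage_compl, probReal_compl_eq_one_sub (hZ i hacc), ← ha i, ← hb i,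
      ← measureReal_union (Set.disjoint_sdiff_inter.symm.preimage _) (hZ i (hacc.diff hhigh)),
      ← Set.preimage_union, Set.inter_union_sdiff]
  have hr0 : 0 ≤ 1 - (a + b) := hr i₀ ▸ measureReal_nonneg
  -- The cell that point $i$ must occupy when exactly $I$ is accepted and exactly $H\subseteq I$ is
  -- high. Independence factorizes the probability of each such pattern.
  let reg (I H : Finset ι) (i : ι) : Set α :=
    if i ∈ H then acc ∩ high else if i ∈ I then acc \ high else accᶜ
  have hregm : ∀ I H i, MeasurableSet (reg I H i) := by
    intro I H i
    simp only [reg]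
    split_ifs
    exacts [hacc.inter hhigh, hacc.diff hhigh, hacc.compl]
  let F (I : Finset ι) : Finset (Finset ι) :=
    I.powerset.filter fun H => (H.card : ℤ) ≤ kIndex I.card ε δ
  have hsub : {ω | ((J.filter fun i => Z i ω ∈ acc ∧ Z i ω ∈ high).card : ℤ)
      ≤ kIndex (J.filter fun i => Z i ω ∈ acc).card ε δ} ⊆
      ⋃ I ∈ J.powerset, ⋃ H ∈ F I, ⋂ i ∈ J, Z i ⁻¹' reg I H i := by
    intro ω hω
    simp only [Set.mem_iUnion]
    refine ⟨J.filter fun i => Z i ω ∈ acc, by simp, J.filter fun i => Z i ω ∈ acc ∧ Z i ω ∈ high,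
      Finset.mem_filter.2 ⟨?_, hω⟩, ?_⟩
    · rw [Finset.mem_powerset]
      intro i
      simp only [Finset.mem_filter]
      tauto
    · simp only [Set.mem_iInter, Set.mem_preimage, reg]
      intro i hi
      by_cases h1 : Z i ω ∈ acc <;> by_cases h2 : Z i ω ∈ high <;> simp [hi, h1, h2]
  have hprod : ∀ I ∈ J.powerset, ∀ H ∈ I.powerset, P.real (⋂ i ∈ J, Z i ⁻¹' reg I H i)
      = a ^ H.card * b ^ (I.card - H.card) * (1 - (a + b)) ^ (J.card - I.card) := by
    intro I hI H hH
    rw [Finset.mem_powerset] at hI hH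
    rw [measureReal_def, hind.measure_inter_preimage_eq_mul J (fun i _ => hregm I H i),
      ENNReal.toReal_prod]
    have hv : ∀ i ∈ J, (P (Z i ⁻¹' reg I H i)).toReal
        = if i ∈ H then a else if i ∈ I then b else 1 - (a + b) := by
      intro i _
      simp only [reg]
      split_ifs
      exacts [ha i, hb i, hr i]
    rw [Finset.prod_congr rfl hv, Finset.prod_ite, Finset.prod_const, Finset.prod_ite,
      Finset.prod_const, Finset.prod_const, ← mul_assoc]
    have e1 : J.filter (· ∈ H) = H := by
      ext i; simp only [Finset.mem_filter]; exact ⟨And.right, fun h => ⟨hI (hH h), h⟩⟩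
    have e2 : (J.filter (· ∉ H)).filter (· ∈ I) = I \ H := by
      ext i; simp only [Finset.mem_filter, Finset.mem_sdiff]
      exact ⟨fun h => ⟨h.2, h.1.2⟩, fun h => ⟨⟨hI h.1, h.2⟩, h.1⟩⟩
    have e3 : (J.filter (· ∉ H)).filter (· ∉ I) = J \ I := by
      ext i; simp only [Finset.mem_filter, Finset.mem_sdiff]
      exact ⟨fun h => ⟨h.1.1, h.2⟩, fun h => ⟨⟨h.1, fun h' => h.2 (hH h')⟩, h.2⟩⟩
    rw [e1, e2, e3, Finset.card_sdiff_of_subset hH, Finset.card_sdiff_of_subset hI]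
  calc _ ≤ P.real (⋃ I ∈ J.powerset, ⋃ H ∈ F I, ⋂ i ∈ J, Z i ⁻¹' reg I H i) :=
        measureReal_mono hsub (measure_ne_top _ _)
    _ ≤ ∑ I ∈ J.powerset, ∑ H ∈ F I, P.real (⋂ i ∈ J, Z i ⁻¹' reg I H i) :=
        (measureReal_biUnion_finset_le _ _).trans
          (Finset.sum_le_sum fun I _ => measureReal_biUnion_finset_le _ _)
    _ = ∑ I ∈ J.powerset, (∑ H ∈ F I, a ^ H.card * b ^ (I.card - H.card))
          * (1 - (a + b)) ^ (J.card - I.card) := by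
        refine Finset.sum_congr rfl fun I hI => ?_
        rw [Finset.sum_mul]
        exact Finset.sum_congr rfl fun H hH => hprod I hI H (Finset.mem_filter.1 hH).1
    _ ≤ ∑ I ∈ J.powerset, ((a + b) ^ I.card * δ) * (1 - (a + b)) ^ (J.card - I.card) := by
        gcongr with I hI
        exact sum_powerset_filter_card_le I ha0 hb0 hε0 hε1 hδ hab
    _ = δ * ∑ I ∈ J.powerset, (a + b) ^ I.card * (1 - (a + b)) ^ (J.card - I.card) := by
        rw [Finset.mul_sum]
        exact Finset.sum_congr rfl fun I _ => by ring
    _ = δ := by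
        -- Summing over all accepted sets is the binomial theorem for $(a+b)+(1-(a+b))=1$.
        rw [Finset.sum_pow_mul_eq_add_pow]
        simp

end Counting
end PACOPP
namespace PACOPP

/-! ### Bandit laws as densities, and $L^1$ distance against Bhattacharyya coefficient. -/

section BanditLaw

variable {S A : Type*} [MeasurableSpace S] [MeasurableSpace A] {ν : Measure A}

theorem Policy.measurable_dens_real (π : Policy S A ν) :
    Measurable fun p : S × A => (π.dens p.1 p.2 : ℝ) := π.measurable_dens.coe_nnreal_real

/-- The expected `L¹` distance between the action densities of two policies. -/
noncomputable def policyDist (PS : Measure S) (π π' : Policy S A ν) : ℝ :=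
  ∫ p, |(π.dens p.1 p.2 : ℝ) - π'.dens p.1 p.2| ∂(PS.prod ν)

/-- The expected Bhattacharyya coefficient of the action densities of two policies. -/
noncomputable def bhattacharyya (PS : Measure S) (π π' : Policy S A ν) : ℝ :=
  ∫ p, √((π.dens p.1 p.2 : ℝ) * π'.dens p.1 p.2) ∂(PS.prod ν)

theorem bhattacharyya_nonneg (PS : Measure S) (π π' : Policy S A ν) :
    0 ≤ bhattacharyya PS π π' := integral_nonneg fun _ => Real.sqrt_nonneg _

variable [SigmaFinite ν]

instance (π : Policy S A ν) : IsMarkovKernel π.kernel := by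
  refine ⟨fun s => ⟨?_⟩⟩
  rw [Policy.kernel, Kernel.withDensity_apply' _ _ _ _, Kernel.const_apply,
    Measure.restrict_univ, π.lintegral_dens s]
  exact π.measurable_dens.coe_nnreal_ennreal

theorem lintegral_banditLaw (PS : Measure S) [IsProbabilityMeasure PS] (PR : Kernel (S × A) ℝ)
    [IsMarkovKernel PR] (π : Policy S A ν) {f : Obs S A → ℝ≥0∞} (hf : Measurable f) :
    ∫⁻ z, f z ∂(banditLaw PS π PR)
      = ∫⁻ p, (π.dens p.1 p.2 : ℝ≥0∞) * ∫⁻ r, f (p, r) ∂(PR p) ∂(PS.prod ν) := by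
  have hm : Measurable (Function.uncurry fun (s : S) (a : A) => (π.dens s a : ℝ≥0∞)) :=
    π.measurable_dens.coe_nnreal_ennreal
  have hg : Measurable fun p => ∫⁻ r, f (p, r) ∂(PR p) := hf.lintegral_kernel_prod_right'
  rw [banditLaw, Measure.lintegral_compProd hf, Measure.lintegral_compProd hg,
    lintegral_prod (fun p => (π.dens p.1 p.2 : ℝ≥0∞) * ∫⁻ r, f (p, r) ∂(PR p))
      (hm.mul hg).aemeasurable]
  refine lintegral_congr fun s => ?_
  have hs : Measurable fun a => ∫⁻ r, f ((s, a), r) ∂(PR (s, a)) := hg.comp measurable_prodMk_left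
  rw [Policy.kernel, Kernel.lintegral_withDensity _ hm _ hs, Kernel.const_apply]

instance (PS : Measure S) [IsProbabilityMeasure PS] (PR : Kernel (S × A) ℝ) [IsMarkovKernel PR]
    (π : Policy S A ν) : IsProbabilityMeasure (banditLaw PS π PR) := by
  unfold banditLaw; infer_instance

theorem Policy.lintegral_prod_dens (π : Policy S A ν) (PS : Measure S) [IsProbabilityMeasure PS] :
    ∫⁻ p, (π.dens p.1 p.2 : ℝ≥0∞) ∂(PS.prod ν) = 1 := by
  rw [lintegral_prod _ π.measurable_dens.coe_nnreal_ennreal.aemeasurable]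
  simp [π.lintegral_dens]

theorem Policy.integrable_dens (π : Policy S A ν) (PS : Measure S) [IsProbabilityMeasure PS] :
    Integrable (fun p : S × A => (π.dens p.1 p.2 : ℝ)) (PS.prod ν) := by
  refine ⟨π.measurable_dens_real.aestronglyMeasurable, ?_⟩
  rw [hasFiniteIntegral_iff_ofReal (Filter.Eventually.of_forall fun p => NNReal.coe_nonneg _)]
  simp [π.lintegral_prod_dens PS]

theorem Policy.integral_dens (π : Policy S A ν) (PS : Measure S) [IsProbabilityMeasure PS] :
    ∫ p, (π.dens p.1 p.2 : ℝ) ∂(PS.prod ν) = 1 := by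
  rw [integral_eq_lintegral_of_nonneg_ae
    (Filter.Eventually.of_forall fun p => NNReal.coe_nonneg _)
    π.measurable_dens_real.aestronglyMeasurable]
  simp [π.lintegral_prod_dens PS]

theorem integrable_sqrt_dens_mul (PS : Measure S) [IsProbabilityMeasure PS]
    (π π' : Policy S A ν) :
    Integrable (fun p : S × A => √((π.dens p.1 p.2 : ℝ) * π'.dens p.1 p.2)) (PS.prod ν) := by
  refine ((π.integrable_dens PS).add (π'.integrable_dens PS)).mono'
    (π.measurable_dens_real.mul π'.measurable_dens_real).sqrt.aestronglyMeasurable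
    (Filter.Eventually.of_forall fun p => ?_)
  rw [Real.norm_of_nonneg (Real.sqrt_nonneg _), Pi.add_apply]
  refine Real.sqrt_le_iff.2 ⟨by positivity, ?_⟩
  nlinarith [(π.dens p.1 p.2).coe_nonneg, (π'.dens p.1 p.2).coe_nonneg,
    mul_nonneg (π.dens p.1 p.2).coe_nonneg (π'.dens p.1 p.2).coe_nonneg]

/-- Weighted AM–GM for $|x-y|=|\sqrt x-\sqrt y|\,(\sqrt x+\sqrt y)$. Once integrated, the free
weight $c$ takes the place of Cauchy–Schwarz. -/
theorem abs_sub_le_of_sqrt {x y c : ℝ} (hx : 0 ≤ x) (hy : 0 ≤ y) (hc : 0 < c) :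
    |x - y| ≤ c / 2 * (x + y - 2 * √(x * y)) + 1 / (2 * c) * (x + y + 2 * √(x * y)) := by
  rw [Real.sqrt_mul hx]
  obtain ⟨u, hu, rfl⟩ : ∃ u, 0 ≤ u ∧ x = u ^ 2 := ⟨√x, Real.sqrt_nonneg _, (Real.sq_sqrt hx).symm⟩
  obtain ⟨v, hv, rfl⟩ : ∃ v, 0 ≤ v ∧ y = v ^ 2 := ⟨√y, Real.sqrt_nonneg _, (Real.sq_sqrt hy).symm⟩
  rw [Real.sqrt_sq hu, Real.sqrt_sq hv]
  have h1 : c / 2 * (u ^ 2 + v ^ 2 - 2 * (u * v)) + 1 / (2 * c) * (u ^ 2 + v ^ 2 + 2 * (u * v))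
      - (u ^ 2 - v ^ 2) = (c * (u - v) - (u + v)) ^ 2 / (2 * c) := by
    field_simp; ring
  have h2 : c / 2 * (u ^ 2 + v ^ 2 - 2 * (u * v)) + 1 / (2 * c) * (u ^ 2 + v ^ 2 + 2 * (u * v))
      + (u ^ 2 - v ^ 2) = (c * (u - v) + (u + v)) ^ 2 / (2 * c) := by
    field_simp; ring
  have h3 : 0 ≤ (c * (u - v) - (u + v)) ^ 2 / (2 * c) := by positivity
  have h4 : 0 ≤ (c * (u - v) + (u + v)) ^ 2 / (2 * c) := by positivity
  rw [abs_le]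
  constructor <;> linarith

theorem integrable_abs_dens_sub (PS : Measure S) [IsProbabilityMeasure PS] (π π' : Policy S A ν) :
    Integrable (fun p : S × A => |(π.dens p.1 p.2 : ℝ) - π'.dens p.1 p.2|) (PS.prod ν) :=
  ((π.integrable_dens PS).sub (π'.integrable_dens PS)).abs

theorem policyDist_le (PS : Measure S) [IsProbabilityMeasure PS] (π π' : Policy S A ν) {c : ℝ}
    (hc : 0 < c) :
    policyDist PS π π' ≤ c * (1 - bhattacharyya PS π π') + (1 + bhattacharyya PS π π') / c := by
  have i1 := π.integrable_dens PS
  have i2 := π'.integrable_dens PS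
  have i3 := (integrable_sqrt_dens_mul PS π π').const_mul 2
  have hs : Integrable (fun p : S × A => (π.dens p.1 p.2 : ℝ) + π'.dens p.1 p.2) (PS.prod ν) :=
    i1.add i2
  have hd : Integrable (fun p : S × A => c / 2 * ((π.dens p.1 p.2 : ℝ) + π'.dens p.1 p.2
      - 2 * √((π.dens p.1 p.2 : ℝ) * π'.dens p.1 p.2))) (PS.prod ν) := (hs.sub i3).const_mul _
  have ha : Integrable (fun p : S × A => 1 / (2 * c) * ((π.dens p.1 p.2 : ℝ) + π'.dens p.1 p.2
      + 2 * √((π.dens p.1 p.2 : ℝ) * π'.dens p.1 p.2))) (PS.prod ν) := (hs.add i3).const_mul _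
  calc policyDist PS π π' ≤ ∫ p, (c / 2 * ((π.dens p.1 p.2 : ℝ) + π'.dens p.1 p.2
          - 2 * √((π.dens p.1 p.2 : ℝ) * π'.dens p.1 p.2))
        + 1 / (2 * c) * ((π.dens p.1 p.2 : ℝ) + π'.dens p.1 p.2
          + 2 * √((π.dens p.1 p.2 : ℝ) * π'.dens p.1 p.2))) ∂(PS.prod ν) :=
        integral_mono (integrable_abs_dens_sub PS π π')
          (hd.add ha)
          fun p => abs_sub_le_of_sqrt (NNReal.coe_nonneg _) (NNReal.coe_nonneg _) hc
    _ = c / 2 * (1 + 1 - 2 * bhattacharyya PS π π')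
        + 1 / (2 * c) * (1 + 1 + 2 * bhattacharyya PS π π') := by
        rw [integral_add hd ha,
          integral_const_mul, integral_const_mul, integral_sub hs i3, integral_add hs i3,
          integral_add i1 i2, integral_const_mul, π.integral_dens, π'.integral_dens]
        rfl
    _ = _ := by field_simp; ring

theorem bhattacharyya_le_one (PS : Measure S) [IsProbabilityMeasure PS] (π π' : Policy S A ν) :
    bhattacharyya PS π π' ≤ 1 := by
  have h : bhattacharyya PS π π'
      ≤ ∫ p, (((π.dens p.1 p.2 : ℝ) + π'.dens p.1 p.2) / 2) ∂(PS.prod ν) := by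
    refine integral_mono (integrable_sqrt_dens_mul PS π π')
      (((π.integrable_dens PS).add (π'.integrable_dens PS)).div_const 2) fun p => ?_
    refine Real.sqrt_le_iff.2 ⟨by positivity, ?_⟩
    nlinarith [sq_nonneg ((π.dens p.1 p.2 : ℝ) - π'.dens p.1 p.2)]
  rw [integral_div, integral_add (π.integrable_dens PS) (π'.integrable_dens PS),
    π.integral_dens, π'.integral_dens] at h
  linarith

theorem bhattacharyya_le_exp_of_lt_policyDist (PS : Measure S) [IsProbabilityMeasure PS]
    (π π' : Policy S A ν) {x : ℝ} (hx : 0 < x) (h : 2 * √(2 * x) < policyDist PS π π') :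
    bhattacharyya PS π π' ≤ Real.exp (-x) := by
  by_contra! hlt
  have h1 : 1 - bhattacharyya PS π π' ≤ x := by
    have := Real.add_one_le_exp (-x)
    linarith
  have hq : 0 < √(2 * x) := Real.sqrt_pos.2 (by linarith)
  have hqq : √(2 * x) * √(2 * x) = 2 * x := Real.mul_self_sqrt (by linarith)
  -- The weight $c=\sqrt{2/x}$ balances the two terms: with $1-\mathrm{BC}\le x$ and
  -- $1+\mathrm{BC}\le2$, each is at most $\sqrt{2x}$.
  have h2 := policyDist_le PS π π' (c := √(2 * x) / x) (by positivity)
  have h3 : √(2 * x) / x * (1 - bhattacharyya PS π π') ≤ √(2 * x) := by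
    calc _ ≤ √(2 * x) / x * x := by gcongr
      _ = _ := by field_simp
  have h4 : (1 + bhattacharyya PS π π') / (√(2 * x) / x) ≤ √(2 * x) := by
    rw [div_le_iff₀ (by positivity), mul_div_assoc', hqq]
    have := bhattacharyya_le_one PS π π'
    field_simp
    linarith
  linarith

end BanditLaw

/-! ### Concentration of maximum likelihood over a finite class. -/

section Likelihood

variable {S A : Type*} [MeasurableSpace S] [MeasurableSpace A] {ν : Measure A}

theorem logLik_eq_log_prod {I : Type*} [Fintype I] (π : Policy S A ν) (d : I → Obs S A) :
    logLik π d = ENNReal.log (∏ i, (π.dens (d i).1.1 (d i).1.2 : ℝ≥0∞)) := by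
  classical
  unfold logLik
  generalize (Finset.univ : Finset I) = s
  induction s using Finset.induction_on with
  | empty => simp
  | insert i s hi ih => rw [Finset.sum_insert hi, Finset.prod_insert hi, ENNReal.log_mul_add, ih]

theorem logLik_le_logLik_iff {I : Type*} [Fintype I] (π π' : Policy S A ν) (d : I → Obs S A) :
    logLik π d ≤ logLik π' d ↔
      ∏ i, π.dens (d i).1.1 (d i).1.2 ≤ ∏ i, π'.dens (d i).1.1 (d i).1.2 := by
  rw [logLik_eq_log_prod, logLik_eq_log_prod, ENNReal.log_le_log_iff]
  norm_cast

variable [SigmaFinite ν]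

theorem lintegral_sqrt_dens_div_le (PS : Measure S) [IsProbabilityMeasure PS]
    (PR : Kernel (S × A) ℝ) [IsMarkovKernel PR] (π πb : Policy S A ν) :
    ∫⁻ z, ENNReal.ofReal √((π.dens z.1.1 z.1.2 : ℝ) / πb.dens z.1.1 z.1.2)
      ∂(banditLaw PS πb PR) ≤ ENNReal.ofReal (bhattacharyya PS π πb) := by
  have hm : Measurable fun p : S × A =>
      ENNReal.ofReal √((π.dens p.1 p.2 : ℝ) / πb.dens p.1 p.2) :=
    (π.measurable_dens_real.div πb.measurable_dens_real).sqrt.ennreal_ofReal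
  have hm' : Measurable fun z : Obs S A =>
      ENNReal.ofReal √((π.dens z.1.1 z.1.2 : ℝ) / πb.dens z.1.1 z.1.2) := hm.comp measurable_fst
  rw [lintegral_banditLaw PS PR πb hm', bhattacharyya,
    ofReal_integral_eq_lintegral_ofReal (integrable_sqrt_dens_mul PS π πb)
      (Filter.Eventually.of_forall fun _ => Real.sqrt_nonneg _)]
  refine lintegral_mono fun p => ?_
  simp only [lintegral_const, measure_univ, mul_one]
  rw [← ENNReal.ofReal_coe_nnreal, ← ENNReal.ofReal_mul (NNReal.coe_nonneg _)]
  refine ENNReal.ofReal_le_ofReal ?_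
  set x : ℝ := (π.dens p.1 p.2 : ℝ)
  set y : ℝ := (πb.dens p.1 p.2 : ℝ)
  have hx : 0 ≤ x := NNReal.coe_nonneg _
  have hy : 0 ≤ y := NNReal.coe_nonneg _
  -- Where $\pi_b$ vanishes the left side carries the factor $0$; elsewhere $y\sqrt{x/y}=\sqrt{xy}$.
  rcases hy.eq_or_lt with h | h
  · rw [← h]; simp
  · refine Real.le_sqrt_of_sq_le ?_
    rw [mul_pow, Real.sq_sqrt (by positivity)]
    field_simp
    rfl

/-- This allows division by the likelihood of $\pi_b$: real division by zero gives $0$, so a ratio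
of likelihoods would otherwise not detect that $\pi$ is at least as likely. -/
theorem ae_dens_ne_zero (PS : Measure S) [IsProbabilityMeasure PS] (PR : Kernel (S × A) ℝ)
    [IsMarkovKernel PR] (πb : Policy S A ν) :
    ∀ᵐ z ∂(banditLaw PS πb PR), πb.dens z.1.1 z.1.2 ≠ 0 := by
  have hs : MeasurableSet {z : Obs S A | πb.dens z.1.1 z.1.2 = 0} :=
    (πb.measurable_dens.comp measurable_fst) (measurableSet_singleton 0)
  rw [ae_iff]
  simp only [not_not]
  rw [← lintegral_indicator_one hs, lintegral_banditLaw PS PR πb (measurable_one.indicator hs)]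
  refine (lintegral_congr fun p => ?_).trans lintegral_zero
  by_cases h : πb.dens p.1 p.2 = 0 <;> simp [h]

/-- Probability bound for a policy to be at least as likely as the true one. -/
theorem measure_logLik_le (PS : Measure S) [IsProbabilityMeasure PS] (PR : Kernel (S × A) ℝ)
    [IsMarkovKernel PR] {Ω I : Type*} [MeasurableSpace Ω] [Fintype I] (P : Measure Ω)
    [IsProbabilityMeasure P] (π πb : Policy S A ν) (Y : I → Ω → Obs S A)
    (hY : ∀ i, Measurable (Y i)) (hlaw : ∀ i, P.map (Y i) = banditLaw PS πb PR)
    (hind : iIndepFun Y P) :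
    P {ω | logLik πb (fun i => Y i ω) ≤ logLik π (fun i => Y i ω)}
      ≤ ENNReal.ofReal (bhattacharyya PS π πb) ^ Fintype.card I := by
  set h : Obs S A → ℝ≥0∞ :=
    fun z => ENNReal.ofReal √((π.dens z.1.1 z.1.2 : ℝ) / πb.dens z.1.1 z.1.2) with hh
  have hm : Measurable h :=
    ((π.measurable_dens_real.div πb.measurable_dens_real).sqrt.ennreal_ofReal).comp measurable_fst
  have hpos : ∀ᵐ ω ∂P, ∀ i, πb.dens (Y i ω).1.1 (Y i ω).1.2 ≠ 0 := by
    rw [ae_all_iff]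
    intro i
    have := ae_dens_ne_zero PS PR πb
    rw [← hlaw i] at this
    exact ae_of_ae_map (hY i).aemeasurable this
  calc P {ω | logLik πb (fun i => Y i ω) ≤ logLik π (fun i => Y i ω)}
      ≤ P {ω | 1 ≤ ∏ i, h (Y i ω)} := by
        refine measure_mono_ae ?_
        filter_upwards [hpos] with ω hω hle
        have hle : ∏ i, πb.dens (Y i ω).1.1 (Y i ω).1.2 ≤ ∏ i, π.dens (Y i ω).1.1 (Y i ω).1.2 :=
          (logLik_le_logLik_iff _ _ _).1 hle
        change (1 : ℝ≥0∞) ≤ ∏ i, h (Y i ω)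
        simp only [hh]
        rw [← ENNReal.ofReal_prod_of_nonneg fun i _ => Real.sqrt_nonneg _,
          ← Real.sqrt_prod _ fun i _ => by positivity, Finset.prod_div_distrib,
          ENNReal.one_le_ofReal, Real.one_le_sqrt, one_le_div₀]
        · exact_mod_cast hle
        · exact Finset.prod_pos fun i _ => NNReal.coe_pos.2 (pos_iff_ne_zero.2 (hω i))
    -- Markov's inequality at level $1$; independence then splits the mean of the product.
    _ ≤ ∫⁻ ω, ∏ i, h (Y i ω) ∂P := by
        have := mul_meas_ge_le_lintegral (μ := P) (f := fun ω => ∏ i, h (Y i ω))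
          (Finset.measurable_prod _ fun i _ => hm.comp (hY i)) 1
        simpa using this
    _ = ∏ i, ∫⁻ ω, h (Y i ω) ∂P :=
        lintegral_prod_eq_prod_lintegral_of_indepFun Finset.univ (fun i ω => h (Y i ω))
          (hind.comp (fun _ => h) fun _ => hm) fun i => hm.comp (hY i)
    _ = ∏ _i : I, ∫⁻ z, h z ∂(banditLaw PS πb PR) := by
        refine Finset.prod_congr rfl fun i _ => ?_
        rw [← hlaw i, lintegral_map hm (hY i)]
    _ ≤ ∏ _i : I, ENNReal.ofReal (bhattacharyya PS π πb) :=
        Finset.prod_le_prod' fun _ _ => lintegral_sqrt_dens_div_le PS PR π πb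
    _ = _ := by simp

/-- The maximum likelihood estimator over a finite class is close to the true policy. -/
theorem measure_lt_policyDist_mle_le (PS : Measure S) [IsProbabilityMeasure PS]
    (PR : Kernel (S × A) ℝ) [IsMarkovKernel PR] {Ω I : Type*} [MeasurableSpace Ω] [Fintype I]
    (P : Measure Ω) [IsProbabilityMeasure P] (Pol : Finset (Policy S A ν)) {πb : Policy S A ν}
    (hπb : πb ∈ Pol) {est : (I → Obs S A) → Policy S A ν} (hest : IsMLE Pol est)
    (Y : I → Ω → Obs S A) (hY : ∀ i, Measurable (Y i))
    (hlaw : ∀ i, P.map (Y i) = banditLaw PS πb PR) (hind : iIndepFun Y P)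
    (hI : 0 < Fintype.card I) {δ₀ : ℝ} (hδ₀ : δ₀ ∈ Set.Ioo (0 : ℝ) 1) :
    P.real {ω | 2 * √(2 * Real.log ((Pol.card : ℝ) / δ₀) / (Fintype.card I : ℝ))
      < policyDist PS (est fun i => Y i ω) πb} ≤ δ₀ := by
  classical
  set m : ℝ := (Fintype.card I : ℝ)
  set x : ℝ := Real.log ((Pol.card : ℝ) / δ₀) / m with hx
  have hm : 0 < m := Nat.cast_pos.2 hI
  have hN : 1 ≤ (Pol.card : ℝ) := by exact_mod_cast Finset.card_pos.2 ⟨πb, hπb⟩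
  have hx0 : 0 < x :=
    div_pos (Real.log_pos ((one_lt_div hδ₀.1).2 (hδ₀.2.trans_le hN))) hm
  rw [mul_div_assoc]
  -- The policies too far from $\pi_b$. If the estimate is one of them, that policy is at least as
  -- likely as $\pi_b$, and the union bound runs over them.
  set B := Pol.filter fun π => 2 * √(2 * x) < policyDist PS π πb
  have hb : ∀ π ∈ B, P.real {ω | logLik πb (fun i => Y i ω) ≤ logLik π (fun i => Y i ω)}
      ≤ δ₀ / Pol.card := by
    intro π hπ
    have h1 := measure_logLik_le PS PR P π πb Y hY hlaw hind
    rw [← ENNReal.ofReal_pow (bhattacharyya_nonneg _ _ _)] at h1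
    refine (ENNReal.toReal_le_of_le_ofReal (by have := bhattacharyya_nonneg PS π πb; positivity)
      h1).trans ?_
    calc bhattacharyya PS π πb ^ Fintype.card I ≤ Real.exp (-x) ^ Fintype.card I :=
          pow_le_pow_left₀ (bhattacharyya_nonneg _ _ _)
            (bhattacharyya_le_exp_of_lt_policyDist PS π πb hx0 (Finset.mem_filter.1 hπ).2) _
      _ = Real.exp (-Real.log ((Pol.card : ℝ) / δ₀)) := by
          rw [← Real.exp_nat_mul, hx]
          congr 1
          change m * _ = _
          field_simp
      _ = δ₀ / Pol.card := by
          rw [Real.exp_neg, Real.exp_log (div_pos (by linarith) hδ₀.1), inv_div]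
  calc _ ≤ P.real (⋃ π ∈ B, {ω | logLik πb (fun i => Y i ω) ≤ logLik π (fun i => Y i ω)}) := by
        refine measureReal_mono (fun ω hω => ?_) (measure_ne_top _ _)
        simp only [Set.mem_iUnion]
        exact ⟨est fun i => Y i ω, Finset.mem_filter.2 ⟨hest.mem _, hω⟩, hest.max _ _ hπb⟩
    _ ≤ ∑ π ∈ B, P.real {ω | logLik πb (fun i => Y i ω) ≤ logLik π (fun i => Y i ω)} :=
        measureReal_biUnion_finset_le _ _
    _ ≤ ∑ _π ∈ B, δ₀ / Pol.card := Finset.sum_le_sum hb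
    _ ≤ ∑ _π ∈ Pol, δ₀ / Pol.card :=
        Finset.sum_le_sum_of_subset_of_nonneg (Finset.filter_subset _ _)
          fun _ _ _ => div_nonneg hδ₀.1.le (by positivity)
    _ = δ₀ := by
        rw [Finset.sum_const, nsmul_eq_mul]
        field_simp

end Likelihood

end PACOPP
namespace PACOPP

/-! ### Rejection sampling, transfer to the target law, and calibration. -/

section Acceptance

variable {S A : Type*} [MeasurableSpace S] [MeasurableSpace A] {ν : Measure A}

/-- The largest importance weight of a target policy with respect to another policy. -/
noncomputable def maxRatio (πe π : Policy S A ν) : ℝ≥0∞ := ⨆ (s : S) (a : A), ratio πe π s a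

theorem ratio_le_maxRatio (πe π : Policy S A ν) (s : S) (a : A) :
    ratio πe π s a ≤ maxRatio πe π := le_iSup₂ (f := fun s a => ratio πe π s a) s a

theorem measurable_ratio (πe π : Policy S A ν) :
    Measurable fun p : S × A => ratio πe π p.1 p.2 :=
  πe.measurable_dens.coe_nnreal_ennreal.div π.measurable_dens.coe_nnreal_ennreal

/-- The probability that rejection sampling keeps an observation. -/
noncomputable def acceptProb (πe π : Policy S A ν) (z : Obs S A) : ℝ≥0∞ :=
  ratio πe π z.1.1 z.1.2 / maxRatio πe π

theorem measurable_acceptProb (πe π : Policy S A ν) : Measurable (acceptProb πe π) :=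
  ((measurable_ratio πe π).comp measurable_fst).div_const _

theorem acceptProb_le_one (πe π : Policy S A ν) (z : Obs S A) : acceptProb πe π z ≤ 1 :=
  ENNReal.div_le_of_le_mul (by simpa using ratio_le_maxRatio πe π z.1.1 z.1.2)

/-- The observations, paired with a uniform variable, which rejection sampling keeps. -/
def acceptSet (πe π : Policy S A ν) : Set (Obs S A × ℝ) :=
  {y | ENNReal.ofReal y.2 ≤ acceptProb πe π y.1}

theorem measurableSet_acceptSet (πe π : Policy S A ν) : MeasurableSet (acceptSet πe π) :=
  measurableSet_le measurable_snd.ennreal_ofReal ((measurable_acceptProb πe π).comp measurable_fst)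

open Classical in
theorem accepted_eq_filter {n : ℕ} (πe π : Policy S A ν) (J : Finset (Fin n))
    (x : Fin n → Obs S A) (v : Fin n → ℝ) :
    accepted (ratio πe π) J x v = J.filter fun i => (x i, v i) ∈ acceptSet πe π := by
  ext i
  simp only [accepted, Finset.mem_filter]
  rfl

theorem volume_unit_ofReal_le {u : ℝ≥0∞} (hu : u ≤ 1) :
    (volume : Measure ℝ).restrict (Set.Icc 0 1) {v | ENNReal.ofReal v ≤ u} = u := by
  have hut : u ≠ ⊤ := (hu.trans_lt ENNReal.one_lt_top).ne
  have hs : MeasurableSet {v : ℝ | ENNReal.ofReal v ≤ u} :=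
    measurableSet_le ENNReal.measurable_ofReal measurable_const
  have h1 : u.toReal ≤ 1 := by simpa using ENNReal.toReal_mono ENNReal.one_ne_top hu
  have : {v : ℝ | ENNReal.ofReal v ≤ u} ∩ Set.Icc 0 1 = Set.Icc 0 u.toReal := by
    ext v
    have : v ∈ {v : ℝ | ENNReal.ofReal v ≤ u} ↔ v ≤ u.toReal :=
      ENNReal.ofReal_le_iff_le_toReal hut
    rw [Set.mem_inter_iff, this, Set.mem_Icc, Set.mem_Icc]
    exact ⟨fun h => ⟨h.2.1, h.1⟩, fun h => ⟨h.2, h.1, h.2.trans h1⟩⟩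
  rw [Measure.restrict_apply hs, this, Real.volume_Icc, sub_zero, ENNReal.ofReal_toReal hut]

/-- A zero supremum would force the target density to vanish, against its integral being $1$. -/
theorem maxRatio_ne_zero [Nonempty S] (πe π : Policy S A ν) : maxRatio πe π ≠ 0 := by
  intro h
  have hz : ∀ s a, (πe.dens s a : ℝ≥0∞) = 0 := by
    intro s a
    have : ratio πe π s a = 0 := le_zero_iff.1 (h ▸ ratio_le_maxRatio πe π s a)
    rw [ratio, ENNReal.div_eq_zero_iff] at this
    exact this.resolve_right ENNReal.coe_ne_top
  have := πe.lintegral_dens (Classical.arbitrary S)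
  simp [hz] at this

variable [SigmaFinite ν]

/-- The (unnormalized) law of an accepted observation. -/
noncomputable def acceptedLaw (PS : Measure S) (πe πb : Policy S A ν) (PR : Kernel (S × A) ℝ)
    (π : Policy S A ν) : Measure (Obs S A) :=
  (banditLaw PS πb PR).withDensity (acceptProb πe π)

/-- Integrate out the uniform variable: given the observation, it passes the test with probability
`acceptProb`. -/
theorem prod_acceptSet_inter (PS : Measure S) (PR : Kernel (S × A) ℝ) (πe πb π : Policy S A ν)
    {G : Set (Obs S A)} (hG : MeasurableSet G) :
    (banditLaw PS πb PR).prod ((volume : Measure ℝ).restrict (Set.Icc 0 1))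
      (acceptSet πe π ∩ Prod.fst ⁻¹' G) = acceptedLaw PS πe πb PR π G := by
  rw [Measure.prod_apply ((measurableSet_acceptSet πe π).inter (measurable_fst hG)),
    acceptedLaw, withDensity_apply _ hG, ← lintegral_indicator hG]
  refine lintegral_congr fun z => ?_
  by_cases hz : z ∈ G
  · rw [Set.indicator_of_mem hz, ← volume_unit_ofReal_le (acceptProb_le_one πe π z)]
    congr 1
    ext v
    simp [acceptSet, hz]
  · rw [Set.indicator_of_notMem hz]
    have : Prod.mk z ⁻¹' (acceptSet πe π ∩ Prod.fst ⁻¹' G) = ∅ := by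
      ext v
      simp [hz]
    rw [this, measure_empty]

variable (PS : Measure S) [IsProbabilityMeasure PS] (PR : Kernel (S × A) ℝ) [IsMarkovKernel PR]

instance (πe πb π : Policy S A ν) : IsFiniteMeasure (acceptedLaw PS πe πb PR π) := by
  refine isFiniteMeasure_withDensity ?_
  refine ((lintegral_mono (acceptProb_le_one πe π)).trans_lt ?_).ne
  simp

theorem banditLaw_apply (π : Policy S A ν) {E : Set (Obs S A)} (hE : MeasurableSet E) :
    banditLaw PS π PR E
      = ∫⁻ p, (π.dens p.1 p.2 : ℝ≥0∞) * PR p (Prod.mk p ⁻¹' E) ∂(PS.prod ν) := by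
  rw [← lintegral_indicator_one hE, lintegral_banditLaw PS PR π (measurable_one.indicator hE)]
  refine lintegral_congr fun p => ?_
  rw [← lintegral_indicator_one (measurable_prodMk_left hE)]
  rfl

/-- Multiplying by $\hat B$ cancels the denominator of the acceptance probability and leaves the
density $\pi_b\hat w$. -/
theorem maxRatio_mul_acceptedLaw {πe πb π : Policy S A ν} (hB : maxRatio πe π ≠ ⊤)
    {E : Set (Obs S A)} (hE : MeasurableSet E) :
    maxRatio πe π * acceptedLaw PS πe πb PR π E
      = ∫⁻ p, (πb.dens p.1 p.2 : ℝ≥0∞) * (ratio πe π p.1 p.2 * PR p (Prod.mk p ⁻¹' E))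
          ∂(PS.prod ν) := by
  have := PS.nonempty_of_neZero
  have hmr : Measurable fun z : Obs S A => ratio πe π z.1.1 z.1.2 :=
    (measurable_ratio πe π).comp measurable_fst
  rw [acceptedLaw, withDensity_apply _ hE, ← lintegral_indicator hE,
    ← lintegral_const_mul _ ((measurable_acceptProb πe π).indicator hE)]
  have : ∀ z, maxRatio πe π * E.indicator (acceptProb πe π) z
      = E.indicator (fun z : Obs S A => ratio πe π z.1.1 z.1.2) z := by
    intro z
    by_cases hz : z ∈ E
    · simp only [Set.indicator_of_mem hz, acceptProb]
      exact ENNReal.mul_div_cancel (maxRatio_ne_zero πe π) hB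
    · simp [hz]
  simp_rw [this]
  rw [lintegral_banditLaw PS PR πb (hmr.indicator hE)]
  refine lintegral_congr fun p => ?_
  rw [← lintegral_indicator_one (measurable_prodMk_left hE), ← lintegral_const_mul _
    (measurable_one.indicator (measurable_prodMk_left hE))]
  congr 2 with r
  by_cases h : (p, r) ∈ E <;> simp [h]

/-- If a set carries at most a fraction `ε` of the accepted law for the estimate `π`, then its
probability under the target policy exceeds `ε` by at most the weighted distance of `π` from the
behavior policy. -/
theorem banditLaw_real_le (πe πb π : Policy S A ν) {B : ℝ≥0} (hB : maxRatio πe π ≤ B) {ε : ℝ}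
    (hε0 : 0 ≤ ε) (hε1 : ε ≤ 1) {E : Set (Obs S A)} (hE : MeasurableSet E)
    (h : (acceptedLaw PS πe πb PR π).real E ≤ ε * (acceptedLaw PS πe πb PR π).real Set.univ) :
    (banditLaw PS πe PR).real E ≤ ε + B * policyDist PS π πb := by
  have hBt : maxRatio πe π ≠ ⊤ := (hB.trans_lt ENNReal.coe_lt_top).ne
  have hrt : ∀ p : S × A, ratio πe π p.1 p.2 ≠ ⊤ := fun p =>
    ((ratio_le_maxRatio πe π p.1 p.2).trans_lt hBt.lt_top).ne
  set w : S × A → ℝ := fun p => (ratio πe π p.1 p.2).toReal with hw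
  set g : S × A → ℝ := fun p => (PR p).real (Prod.mk p ⁻¹' E) with hg
  have hgm' : Measurable fun p => PR p (Prod.mk p ⁻¹' E) := Kernel.measurable_kernel_prodMk_left hE
  have hgm : Measurable g := hgm'.ennreal_toReal
  have hwm : Measurable w := (measurable_ratio πe π).ennreal_toReal
  have hw0 : ∀ p, 0 ≤ w p := fun p => ENNReal.toReal_nonneg
  have hwB : ∀ p, w p ≤ B := fun p => by
    simpa using ENNReal.toReal_mono ENNReal.coe_ne_top ((ratio_le_maxRatio πe π p.1 p.2).trans hB)
  have hg0 : ∀ p, 0 ≤ g p := fun p => measureReal_nonneg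
  have hg1 : ∀ p, g p ≤ 1 := fun p => measureReal_le_one
  -- Finiteness of the ratio forces $\pi_e=0$ wherever $\pi=0$, so the identity holds everywhere.
  have hwe : ∀ p : S × A, (πe.dens p.1 p.2 : ℝ) = w p * π.dens p.1 p.2 := by
    intro p
    by_cases h0 : π.dens p.1 p.2 = 0
    · have h1 : πe.dens p.1 p.2 = 0 := by
        by_contra h1
        refine hrt p ?_
        rw [ratio, h0, ENNReal.coe_zero, ENNReal.div_zero]
        exact_mod_cast h1
      simp [h0, h1]
    · have : (π.dens p.1 p.2 : ℝ) ≠ 0 := by exact_mod_cast h0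
      simp only [hw, ratio, ENNReal.toReal_div, ENNReal.coe_toReal]
      field_simp
  have h1 : (banditLaw PS πe PR).real E = ∫ p, (πe.dens p.1 p.2 : ℝ) * g p ∂(PS.prod ν) := by
    rw [measureReal_def, banditLaw_apply PS PR πe hE, ← integral_toReal]
    · simp [hg, measureReal_def]
    · exact (πe.measurable_dens.coe_nnreal_ennreal.mul hgm').aemeasurable
    · exact Filter.Eventually.of_forall fun p =>
        ENNReal.mul_lt_top ENNReal.coe_lt_top (measure_lt_top _ _)
  have h2 : ∀ F : Set (Obs S A), MeasurableSet F →
      (maxRatio πe π).toReal * (acceptedLaw PS πe πb PR π).real F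
      = ∫ p, (πb.dens p.1 p.2 : ℝ) * (w p * (PR p).real (Prod.mk p ⁻¹' F)) ∂(PS.prod ν) := by
    intro F hF
    rw [measureReal_def, ← ENNReal.toReal_mul, maxRatio_mul_acceptedLaw PS PR hBt hF,
      ← integral_toReal]
    · simp [hw, measureReal_def]
    · exact (πb.measurable_dens.coe_nnreal_ennreal.mul
        ((measurable_ratio πe π).mul (Kernel.measurable_kernel_prodMk_left hF))).aemeasurable
    · exact Filter.Eventually.of_forall fun p =>
        ENNReal.mul_lt_top ENNReal.coe_lt_top
          (ENNReal.mul_lt_top (hrt p).lt_top (measure_lt_top _ _))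
  have h3 : ∫ p, (πb.dens p.1 p.2 : ℝ) * (w p * g p) ∂(PS.prod ν)
      ≤ ε * ∫ p, (πb.dens p.1 p.2 : ℝ) * w p ∂(PS.prod ν) := by
    have hu := h2 Set.univ MeasurableSet.univ
    simp only [Set.preimage_univ, probReal_univ, mul_one] at hu
    rw [← h2 E hE, ← hu, mul_left_comm]
    exact mul_le_mul_of_nonneg_left h ENNReal.toReal_nonneg
  have ie := πe.integrable_dens PS
  have ieg : Integrable (fun p : S × A => (πe.dens p.1 p.2 : ℝ) * g p) (PS.prod ν) :=
    ie.mul_bdd (c := 1) hgm.aestronglyMeasurable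
      (Filter.Eventually.of_forall fun p => by rw [Real.norm_of_nonneg (hg0 p)]; exact hg1 p)
  have ib : Integrable (fun p : S × A => (πb.dens p.1 p.2 : ℝ) * w p) (PS.prod ν) :=
    (πb.integrable_dens PS).mul_bdd (c := B) hwm.aestronglyMeasurable
      (Filter.Eventually.of_forall fun p => by rw [Real.norm_of_nonneg (hw0 p)]; exact hwB p)
  have ibg : Integrable (fun p : S × A => (πb.dens p.1 p.2 : ℝ) * (w p * g p)) (PS.prod ν) := by
    simpa only [mul_assoc] using ib.mul_bdd (c := 1) hgm.aestronglyMeasurable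
      (Filter.Eventually.of_forall fun p => by rw [Real.norm_of_nonneg (hg0 p)]; exact hg1 p)
  -- The left side equals $w(g-\epsilon)(\pi-\pi_b)$. Centring at $\epsilon$ gives
  -- $|g-\epsilon|\le1$, hence the factor $B$ alone, and the subtracted bracket has nonpositive
  -- integral by `h3`.
  have hp : ∀ p : S × A, (πe.dens p.1 p.2 : ℝ) * g p - ε * πe.dens p.1 p.2
      - ((πb.dens p.1 p.2 : ℝ) * (w p * g p) - ε * ((πb.dens p.1 p.2 : ℝ) * w p))
      ≤ B * |(π.dens p.1 p.2 : ℝ) - πb.dens p.1 p.2| := by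
    intro p
    calc _ = w p * ((g p - ε) * ((π.dens p.1 p.2 : ℝ) - πb.dens p.1 p.2)) := by
          rw [hwe p]; ring
      _ ≤ w p * |(π.dens p.1 p.2 : ℝ) - πb.dens p.1 p.2| := by
          refine mul_le_mul_of_nonneg_left ((le_abs_self _).trans ?_) (hw0 p)
          rw [abs_mul]
          refine mul_le_of_le_one_left (abs_nonneg _) (abs_le.2 ⟨?_, ?_⟩)
          · linarith [hg0 p]
          · linarith [hg1 p]
      _ ≤ _ := mul_le_mul_of_nonneg_right (hwB p) (abs_nonneg _)
  have i1 : Integrable (fun p : S × A => (πe.dens p.1 p.2 : ℝ) * g p - ε * πe.dens p.1 p.2)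
      (PS.prod ν) := ieg.sub (ie.const_mul ε)
  have i2 : Integrable (fun p : S × A => (πb.dens p.1 p.2 : ℝ) * (w p * g p)
      - ε * ((πb.dens p.1 p.2 : ℝ) * w p)) (PS.prod ν) := ibg.sub (ib.const_mul ε)
  have h4 := integral_mono (i1.sub i2) ((integrable_abs_dens_sub PS π πb).const_mul (B : ℝ)) hp
  rw [integral_const_mul] at h4
  have h5 : ∫ p, ((fun p : S × A => (πe.dens p.1 p.2 : ℝ) * g p - ε * πe.dens p.1 p.2)
      - fun p : S × A => (πb.dens p.1 p.2 : ℝ) * (w p * g p)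
        - ε * ((πb.dens p.1 p.2 : ℝ) * w p)) p ∂(PS.prod ν)
      = (∫ p, (πe.dens p.1 p.2 : ℝ) * g p ∂(PS.prod ν)) - ε
        - (∫ p, (πb.dens p.1 p.2 : ℝ) * (w p * g p) ∂(PS.prod ν)
          - ε * ∫ p, (πb.dens p.1 p.2 : ℝ) * w p ∂(PS.prod ν)) := by
    rw [integral_sub' i1 i2, integral_sub ieg (ie.const_mul ε), integral_sub ibg (ib.const_mul ε),
      integral_const_mul, integral_const_mul, πe.integral_dens, mul_one]
  rw [h5] at h4
  rw [h1]
  change _ ≤ ε + B * ∫ p, |(π.dens p.1 p.2 : ℝ) - πb.dens p.1 p.2| ∂(PS.prod ν)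
  linarith

open Classical in
/-- The PAC guarantee of the calibration step under the law of the accepted observations. -/
theorem measureReal_calibration_fails_le {Ω ι : Type*} [MeasurableSpace Ω] (P : Measure Ω)
    [IsProbabilityMeasure P] (πe πb π : Policy S A ν) (J : Finset ι) {Z : ι → Ω → Obs S A × ℝ}
    (hZ : ∀ i, Measurable (Z i))
    (hlaw : ∀ i, P.map (Z i)
      = (banditLaw PS πb PR).prod ((volume : Measure ℝ).restrict (Set.Icc 0 1)))
    (hind : iIndepFun Z P) {t : Obs S A → ℝ} (ht : Measurable t) {ε δ : ℝ} (hε0 : 0 < ε)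
    (hε1 : ε < 1) (hδ : 0 ≤ δ) :
    P.real {ω | ε * (acceptedLaw PS πe πb PR π).real Set.univ
      < (acceptedLaw PS πe πb PR π).real
        {z | ((J.filter fun i => Z i ω ∈ acceptSet πe π ∧ t z ≤ t (Z i ω).1).card : ℤ)
          ≤ kIndex (J.filter fun i => Z i ω ∈ acceptSet πe π).card ε δ}} ≤ δ := by
  set M := acceptedLaw PS πe πb PR π with hM
  -- If almost surely nothing is accepted, the failure event reads $0<0$.
  rcases eq_or_ne (M Set.univ) 0 with h0 | h0
  · rw [Measure.measure_univ_eq_zero] at h0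
    simp [h0, hδ]
  have hlt : ENNReal.ofReal ε * M Set.univ < (M.map t) Set.univ := by
    rw [Measure.map_apply ht MeasurableSet.univ, Set.preimage_univ]
    calc _ < 1 * M Set.univ :=
          ENNReal.mul_lt_mul_left h0 (measure_ne_top _ _) (by simpa using hε1)
      _ = _ := one_mul _
  -- Scores may have atoms, so both half-lines at $q$ are used: high points ($t\ge q$) carry at
  -- least a fraction $\epsilon$, while $t>q$ carries at most $\epsilon$.
  obtain ⟨q, hq1, hq2⟩ := exists_upper_quantile (M.map t)
    (mul_ne_zero (by simpa using hε0) h0) hlt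
  rw [Measure.map_apply ht measurableSet_Ioi] at hq1
  rw [Measure.map_apply ht measurableSet_Ici] at hq2
  set high : Set (Obs S A × ℝ) := Prod.fst ⁻¹' (t ⁻¹' Set.Ici q) with hhigh
  have hhm : MeasurableSet (t ⁻¹' Set.Ici q) := ht measurableSet_Ici
  have ha : ∀ i, P.real (Z i ⁻¹' (acceptSet πe π ∩ high)) = M.real (t ⁻¹' Set.Ici q) := by
    intro i
    rw [measureReal_def, ← Measure.map_apply (hZ i)
      ((measurableSet_acceptSet πe π).inter (measurable_fst hhm)), hlaw i,
      prod_acceptSet_inter PS PR πe πb π hhm, measureReal_def]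
  have hb : ∀ i, P.real (Z i ⁻¹' (acceptSet πe π \ high)) = M.real (t ⁻¹' Set.Ici q)ᶜ := by
    intro i
    rw [Set.sdiff_eq, hhigh, ← Set.preimage_compl, measureReal_def, ← Measure.map_apply (hZ i)
      ((measurableSet_acceptSet πe π).inter (measurable_fst hhm.compl)), hlaw i,
      prod_acceptSet_inter PS PR πe πb π hhm.compl, measureReal_def]
  refine (measureReal_mono (fun ω hω => ?_) (measure_ne_top _ _)).trans
    (measureReal_card_high_le P J hZ hind (measurableSet_acceptSet πe π) (measurable_fst hhm)
      ha hb hε0.le hε1.le hδ ?_)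
  -- If more than $k$ accepted scores reach $q$, every missed point has score above $q$, so the
  -- missed mass is at most $\epsilon$ times the total.
  · by_contra hcard
    rw [Set.mem_ofPred_eq, not_le, ← hhigh] at hcard
    have hsub : {z | ((J.filter fun i => Z i ω ∈ acceptSet πe π ∧ t z ≤ t (Z i ω).1).card : ℤ)
        ≤ kIndex (J.filter fun i => Z i ω ∈ acceptSet πe π).card ε δ} ⊆ t ⁻¹' Set.Ioi q := by
      intro z hz
      by_contra hzq
      have hzq : t z ≤ q := not_lt.1 hzq
      rw [Set.mem_ofPred_eq] at hz
      have : (J.filter fun i => Z i ω ∈ acceptSet πe π ∧ Z i ω ∈ high).card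
          ≤ (J.filter fun i => Z i ω ∈ acceptSet πe π ∧ t z ≤ t (Z i ω).1).card :=
        Finset.card_le_card (Finset.monotone_filter_right _ fun i _ h => ⟨h.1, hzq.trans h.2⟩)
      omega
    have h1 := ENNReal.toReal_mono (by finiteness) ((measure_mono hsub).trans hq1)
    rw [ENNReal.toReal_mul, ENNReal.toReal_ofReal hε0.le] at h1
    exact absurd hω (not_lt.2 h1)
  · rw [measureReal_add_measureReal_compl hhm]
    have h1 := ENNReal.toReal_mono (measure_ne_top _ _) hq2
    rwa [ENNReal.toReal_mul, ENNReal.toReal_ofReal hε0.le] at h1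

end Acceptance
end PACOPP
namespace PACOPP

/-! ### Independence of data blocks and conditioning on the data. -/

section Independence

variable {Ω : Type*} [MeasurableSpace Ω] {P : Measure Ω} [IsProbabilityMeasure P]

/-- The joint law is a product of two product measures; regrouping its factors index by index gives
a product of the pair laws. -/
theorem iIndepFun_prodMk {ι α β : Type*} [Fintype ι] [MeasurableSpace α] [MeasurableSpace β]
    {X : ι → Ω → α} {V : ι → Ω → β} (hX : ∀ i, Measurable (X i)) (hV : ∀ i, Measurable (V i))
    (hXi : iIndepFun X P) (hVi : iIndepFun V P)
    (hXV : IndepFun (fun ω i => X i ω) (fun ω i => V i ω) P) :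
    iIndepFun (fun i ω => (X i ω, V i ω)) P := by
  have hXm : ∀ i, IsProbabilityMeasure (P.map (X i)) :=
    fun i => Measure.isProbabilityMeasure_map (hX i).aemeasurable
  have hVm : ∀ i, IsProbabilityMeasure (P.map (V i)) :=
    fun i => Measure.isProbabilityMeasure_map (hV i).aemeasurable
  rw [iIndepFun_iff_map_fun_eq_pi_map fun i => ((hX i).prodMk (hV i)).aemeasurable]
  have hpair : ∀ i, P.map (fun ω => (X i ω, V i ω)) = (P.map (X i)).prod (P.map (V i)) :=
    fun i => (hXV.comp (measurable_pi_apply i) (measurable_pi_apply i)).map_prod_eq_prod_map_map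
      (hX i).aemeasurable (hV i).aemeasurable
  simp_rw [hpair]
  have hjoint : P.map (fun ω => ((fun i => X i ω), (fun i => V i ω)))
      = (Measure.pi fun i => P.map (X i)).prod (Measure.pi fun i => P.map (V i)) := by
    rw [hXV.map_prod_eq_prod_map_map (measurable_pi_lambda _ hX).aemeasurable
      (measurable_pi_lambda _ hV).aemeasurable, hXi.map_fun_eq_pi_map fun i => (hX i).aemeasurable,
      hVi.map_fun_eq_pi_map fun i => (hV i).aemeasurable]
  have hmp := (measurePreserving_arrowProdEquivProdArrow α β ι (fun i => P.map (X i))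
    (fun i => P.map (V i))).symm
  rw [← hmp.map_eq, ← hjoint, Measure.map_map (MeasurableEquiv.measurable _)
    ((measurable_pi_lambda _ hX).prodMk (measurable_pi_lambda _ hV))]
  rfl

/-- Lower bound for the probability of an event that, given the coordinates outside of `J` and
a condition `G₁` on them, holds with probability at least `c`. -/
theorem mul_le_measure_of_iIndepFun {ι β : Type*} [Fintype ι] [DecidableEq ι] [MeasurableSpace β]
    {Z : ι → Ω → β} (hZ : ∀ i, Measurable (Z i)) (hind : iIndepFun Z P) (J : Finset ι)
    {G : Set (ι → β)} (hG : MeasurableSet G) {G₁ : Set (↥Jᶜ → β)} (hG₁ : MeasurableSet G₁)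
    {c : ℝ≥0∞} (hc : ∀ u ∈ G₁, c ≤ P {ω |
      (fun i => if h : i ∈ J then Z i ω else u ⟨i, Finset.mem_compl.2 h⟩) ∈ G}) :
    c * P {ω | (fun i : ↥Jᶜ => Z i ω) ∈ G₁} ≤ P {ω | (fun i => Z i ω) ∈ G} := by
  set U : Ω → ↥Jᶜ → β := fun ω i => Z i ω
  set W : Ω → ↥J → β := fun ω i => Z i ω
  have hU : Measurable U := measurable_pi_lambda _ fun i => hZ i
  have hW : Measurable W := measurable_pi_lambda _ fun i => hZ i
  -- Independence of the two blocks lets Fubini evaluate the probability with the block outside $J$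
  -- frozen.
  have hUW : IndepFun U W P := hind.indepFun_finset Jᶜ J disjoint_compl_left hZ
  let mg : (↥Jᶜ → β) × (↥J → β) → ι → β :=
    fun y i => if h : i ∈ J then y.2 ⟨i, h⟩ else y.1 ⟨i, Finset.mem_compl.2 h⟩
  have hmg : Measurable mg := by
    refine measurable_pi_lambda _ fun i => ?_
    by_cases h : i ∈ J
    · simp only [mg, h, dite_true]; fun_prop
    · simp only [mg, h, dite_false]; fun_prop
  have hprob : IsProbabilityMeasure (P.map W) := Measure.isProbabilityMeasure_map hW.aemeasurable
  have h1 : P {ω | (fun i => Z i ω) ∈ G} = ∫⁻ u, P.map W (Prod.mk u ⁻¹' (mg ⁻¹' G)) ∂(P.map U) := by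
    rw [← Measure.prod_apply (hmg hG), ← hUW.map_prod_eq_prod_map_map hU.aemeasurable
      hW.aemeasurable, Measure.map_apply (hU.prodMk hW) (hmg hG)]
    congr 1
    ext ω
    have : mg (U ω, W ω) = fun i => Z i ω := by
      ext i
      by_cases h : i ∈ J <;> simp [mg, h, U, W]
    change _ ↔ mg (U ω, W ω) ∈ G
    rw [this]
    rfl
  calc c * P {ω | (fun i : ↥Jᶜ => Z i ω) ∈ G₁} = ∫⁻ _ in G₁, c ∂(P.map U) := by
        rw [setLIntegral_const, Measure.map_apply hU hG₁]
        rfl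
    _ ≤ ∫⁻ u in G₁, P.map W (Prod.mk u ⁻¹' (mg ⁻¹' G)) ∂(P.map U) := by
        refine setLIntegral_mono (measurable_measure_prodMk_left (hmg hG)) fun u hu => ?_
        rw [Measure.map_apply hW (measurable_prodMk_left (hmg hG))]
        exact hc u hu
    _ ≤ ∫⁻ u, P.map W (Prod.mk u ⁻¹' (mg ⁻¹' G)) ∂(P.map U) := setLIntegral_le_lintegral _ _
    _ = _ := h1.symm

/-- Conditional probability of an event about the data and an independent point. -/
theorem condExp_indicator_eq_of_indepFun {𝒟 E : Type*} [MeasurableSpace 𝒟] [MeasurableSpace E]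
    {data : Ω → 𝒟} {T : Ω → E} (hd : Measurable data) (hT : Measurable T) (h : IndepFun T data P)
    {s : Set (𝒟 × E)} (hs : MeasurableSet s) :
    (fun ω => (P.map T).real (Prod.mk (data ω) ⁻¹' s)) =ᵐ[P]
      P⟦{ω | (data ω, T ω) ∈ s} | MeasurableSpace.comap data inferInstance⟧ := by
  have hprob : IsProbabilityMeasure (P.map T) := Measure.isProbabilityMeasure_map hT.aemeasurable
  have hm : MeasurableSpace.comap data inferInstance ≤ (inferInstance : MeasurableSpace Ω) :=
    hd.comap_le
  have hf : Measurable fun d => (P.map T) (Prod.mk d ⁻¹' s) := measurable_measure_prodMk_left hs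
  have hfr : Measurable fun d => (P.map T).real (Prod.mk d ⁻¹' s) := hf.ennreal_toReal
  have hset : MeasurableSet {ω | (data ω, T ω) ∈ s} := (hd.prodMk hT) hs
  -- The section mass is a function of the data, so only its integrals over data events need
  -- checking; these follow from Fubini for the product law.
  refine ae_eq_condExp_of_forall_setIntegral_eq hm ((integrable_const (1 : ℝ)).indicator hset)
    (fun B _ _ => ?_) ?_ ?_
  · refine (Integrable.of_bound (hfr.comp hd).aestronglyMeasurable 1
      (Filter.Eventually.of_forall fun ω => ?_)).integrableOn
    rw [Function.comp, Real.norm_of_nonneg measureReal_nonneg]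
    exact measureReal_le_one
  · rintro _ ⟨B, hB, rfl⟩ _
    rw [setIntegral_indicator hset, setIntegral_const, smul_eq_mul, mul_one]
    simp only [measureReal_def]
    have hfd : Measurable fun ω => (P.map T) (Prod.mk (data ω) ⁻¹' s) := hf.comp hd
    rw [integral_toReal hfd.aemeasurable
      (Filter.Eventually.of_forall fun ω => measure_lt_top _ _),
      ← setLIntegral_map hB hf hd]
    congr 1
    have hBs : MeasurableSet (B ×ˢ Set.univ ∩ s) := (hB.prod MeasurableSet.univ).inter hs
    have : data ⁻¹' B ∩ {ω | (data ω, T ω) ∈ s}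
        = (fun ω => (data ω, T ω)) ⁻¹' (B ×ˢ Set.univ ∩ s) := by
      ext ω; simp
    rw [this, ← Measure.map_apply (hd.prodMk hT) hBs,
      h.symm.map_prod_eq_prod_map_map hd.aemeasurable hT.aemeasurable, Measure.prod_apply hBs,
      ← lintegral_indicator hB]
    refine lintegral_congr fun d => ?_
    by_cases hdB : d ∈ B
    · rw [Set.indicator_of_mem hdB]
      congr 1
      ext t; simp [hdB]
    · rw [Set.indicator_of_notMem hdB]
      have : Prod.mk d ⁻¹' (B ×ˢ Set.univ ∩ s) = ∅ := by
        ext t; simp [hdB]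
      rw [this, measure_empty]
  · exact (hfr.comp (comap_measurable data)).aestronglyMeasurable

end Independence
end PACOPP
namespace PACOPP

/-! ### Measurability of the miss event. -/

section Measurability

theorem measurableSet_card_filter_le {Y ι : Type*} [MeasurableSpace Y] (I : Finset ι)
    (r : ι → Y → Prop) [∀ y, DecidablePred fun i => r i y]
    (hr : ∀ i, MeasurableSet {y | r i y}) (k : ℤ) :
    MeasurableSet {y | ((I.filter fun i => r i y).card : ℤ) ≤ k} := by
  have h : Measurable fun y => (I.filter fun i => r i y).card := by
    simp_rw [Finset.card_filter]
    exact Finset.measurable_sum _ fun i _ => Measurable.ite (hr i) measurable_const measurable_const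
  exact h (Set.to_countable {m : ℕ | (m : ℤ) ≤ k}).measurableSet

variable {S A : Type*} [MeasurableSpace S] [MeasurableSpace A] {ν : Measure A} {n : ℕ}

theorem measurable_pairs (I : Finset (Fin n)) :
    Measurable fun x : Fin n → Obs S A => pairs I x := by
  unfold pairs; fun_prop

theorem measurableSet_accepted_eq (πe π : Policy S A ν) (J I : Finset (Fin n)) :
    MeasurableSet {d : (Fin n → Obs S A) × (Fin n → ℝ) |
      accepted (ratio πe π) J d.1 d.2 = I} := by
  have : {d : (Fin n → Obs S A) × (Fin n → ℝ) | accepted (ratio πe π) J d.1 d.2 = I}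
      = ⋂ i, {d | (i ∈ J ∧ (d.1 i, d.2 i) ∈ acceptSet πe π) ↔ i ∈ I} := by
    ext d
    simp [accepted_eq_filter, Finset.ext_iff]
  rw [this]
  refine MeasurableSet.iInter fun i => ?_
  have h : MeasurableSet {d : (Fin n → Obs S A) × (Fin n → ℝ) |
      (d.1 i, d.2 i) ∈ acceptSet πe π} := by
    have hm : Measurable fun d : (Fin n → Obs S A) × (Fin n → ℝ) => (d.1 i, d.2 i) := by fun_prop
    exact hm (measurableSet_acceptSet πe π)
  by_cases h1 : i ∈ J <;> by_cases h2 : i ∈ I <;> simp only [h1, h2, true_and, false_and, iff_true,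
    iff_false]
  · exact h
  · exact h.compl
  · exact MeasurableSet.const _
  · exact MeasurableSet.const _

/-- The data and test points for which the prediction set misses the reward of the test point. -/
def missSet (J : Finset (Fin n)) (πe : Policy S A ν) (est : (↥Jᶜ → Obs S A) → Policy S A ν)
    (qalg : QuantileAlg S) (ε δ εlo εup : ℝ) :
    Set (((Fin n → Obs S A) × (Fin n → ℝ)) × Obs S A) :=
  {y | y.2.2 ∉ pacopp J πe est qalg ε δ εlo εup y.1.1 y.1.2 y.2.1.1}

/-- The score of an observation when the quantile functions are estimated from the accepted
observations with indices in `I`. -/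
noncomputable def trainedScore (qalg : QuantileAlg S) (εlo εup : ℝ) (I : Finset (Fin n))
    (x : Fin n → Obs S A) (z : Obs S A) : ℝ :=
  score (qalg _ (pairs I x) εlo) (qalg _ (pairs I x) εup) (z.1.1, z.2)

theorem measurable_trainedScore {qalg : QuantileAlg S}
    (hqalg : ∀ (m : ℕ) (α : ℝ), Measurable fun p : (Fin m → S × ℝ) × S => qalg m p.1 α p.2)
    (εlo εup : ℝ) (I : Finset (Fin n)) :
    Measurable fun y : (Fin n → Obs S A) × Obs S A => trainedScore qalg εlo εup I y.1 y.2 := by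
  have hq : ∀ α, Measurable fun y : (Fin n → Obs S A) × Obs S A =>
      qalg _ (pairs I y.1) α y.2.1.1 := fun α =>
    (hqalg _ α).comp (((measurable_pairs I).comp measurable_fst).prodMk (by fun_prop))
  have hr : Measurable fun y : (Fin n → Obs S A) × Obs S A => y.2.2 := by fun_prop
  exact ((hq εlo).sub hr).max (hr.sub (hq εup))

/-- Fixing the estimated policy and both accepted index sets removes the data-dependent sample
sizes, leaving a count of comparisons between measurable scores. -/
theorem mem_missSet_iff {J : Finset (Fin n)} {πe : Policy S A ν}
    {est : (↥Jᶜ → Obs S A) → Policy S A ν} {qalg : QuantileAlg S} {ε δ εlo εup : ℝ} (hδ : 0 ≤ δ)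
    {x : Fin n → Obs S A} {v : Fin n → ℝ} {z : Obs S A} {π : Policy S A ν}
    (hπ : est (fun i => x i) = π) {I₁ I₂ : Finset (Fin n)}
    (h₁ : accepted (ratio πe π) Jᶜ x v = I₁) (h₂ : accepted (ratio πe π) J x v = I₂) :
    ((x, v), z) ∈ missSet J πe est qalg ε δ εlo εup ↔
      ((I₂.filter fun i => trainedScore qalg εlo εup I₁ x z
        ≤ trainedScore qalg εlo εup I₁ x (x i)).card : ℤ) ≤ kIndex I₂.card ε δ := by
  subst hπ h₁ h₂
  exact notMem_pacCP_pairs_iff _ _ _ hδ _ _ _ _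

theorem measurableSet_missSet {J : Finset (Fin n)} (πe : Policy S A ν)
    {Pol : Finset (Policy S A ν)} {est : (↥Jᶜ → Obs S A) → Policy S A ν} (hest : IsMLE Pol est)
    {qalg : QuantileAlg S}
    (hqalg : ∀ (m : ℕ) (α : ℝ), Measurable fun p : (Fin m → S × ℝ) × S => qalg m p.1 α p.2)
    (ε : ℝ) {δ : ℝ} (hδ : 0 ≤ δ) (εlo εup : ℝ) :
    MeasurableSet (missSet J πe est qalg ε δ εlo εup) := by
  have : missSet J πe est qalg ε δ εlo εup
      = ⋃ (π : ↥Pol) (I₁ : Finset (Fin n)) (I₂ : Finset (Fin n)),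
        (((fun y => fun i : ↥Jᶜ => y.1.1 i) ⁻¹' {d | est d = π}) ∩
          (Prod.fst ⁻¹' {d | accepted (ratio πe π) Jᶜ d.1 d.2 = I₁}) ∩
          (Prod.fst ⁻¹' {d | accepted (ratio πe π) J d.1 d.2 = I₂})) ∩
        {y | ((I₂.filter fun i => trainedScore qalg εlo εup I₁ y.1.1 y.2
          ≤ trainedScore qalg εlo εup I₁ y.1.1 (y.1.1 i)).card : ℤ) ≤ kIndex I₂.card ε δ} := by
    ext ⟨⟨x, v⟩, z⟩
    simp only [Set.mem_iUnion, Set.mem_inter_iff, Set.mem_preimage, Set.mem_ofPred_eq]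
    constructor
    · intro h
      exact ⟨⟨est fun i => x i, hest.mem _⟩, _, _, ⟨⟨rfl, rfl⟩, rfl⟩,
        (mem_missSet_iff hδ rfl rfl rfl).1 h⟩
    · rintro ⟨π, I₁, I₂, ⟨⟨h1, h2⟩, h3⟩, h4⟩
      exact (mem_missSet_iff hδ h1 h2 h3).2 h4
  rw [this]
  refine MeasurableSet.iUnion fun π => MeasurableSet.iUnion fun I₁ => MeasurableSet.iUnion fun I₂ =>
    (((?_ : MeasurableSet _).inter (measurable_fst (measurableSet_accepted_eq πe π _ I₁))).inter
      (measurable_fst (measurableSet_accepted_eq πe π _ I₂))).inter ?_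
  · have hm : Measurable fun (y : ((Fin n → Obs S A) × (Fin n → ℝ)) × Obs S A) (i : ↥Jᶜ) =>
        y.1.1 (i : Fin n) := by fun_prop
    exact hm (hest.measurable π π.2)
  · refine measurableSet_card_filter_le I₂ _ (fun i => measurableSet_le ?_ ?_) _
    · exact (measurable_trainedScore hqalg εlo εup I₁).comp
        (f := fun y : ((Fin n → Obs S A) × (Fin n → ℝ)) × Obs S A => (y.1.1, y.2)) (by fun_prop)
    · exact (measurable_trainedScore hqalg εlo εup I₁).comp
        (f := fun y : ((Fin n → Obs S A) × (Fin n → ℝ)) × Obs S A => (y.1.1, y.1.1 i))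
        (by fun_prop)

end Measurability

/-! ### Calibration conditional on the first part, and the final combination. -/

section Main

variable {S A : Type*} [MeasurableSpace S] [MeasurableSpace A] {ν : Measure A} [SigmaFinite ν]
  {n : ℕ}

/-- The data for which the prediction set has miscoverage at most `ε` under the law of the accepted
observations. -/
def calibratedSet (PS : Measure S) (πb : Policy S A ν) (PR : Kernel (S × A) ℝ)
    (J : Finset (Fin n)) (πe : Policy S A ν) (est : (↥Jᶜ → Obs S A) → Policy S A ν)
    (qalg : QuantileAlg S) (ε δ εlo εup : ℝ) : Set ((Fin n → Obs S A) × (Fin n → ℝ)) :=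
  {d | (acceptedLaw PS πe πb PR (est fun i => d.1 i)).real
      (Prod.mk d ⁻¹' missSet J πe est qalg ε δ εlo εup)
    ≤ ε * (acceptedLaw PS πe πb PR (est fun i => d.1 i)).real Set.univ}

variable (PS : Measure S) [IsProbabilityMeasure PS] (PR : Kernel (S × A) ℝ) [IsMarkovKernel PR]

theorem measurableSet_calibratedSet (πb : Policy S A ν) {J : Finset (Fin n)} (πe : Policy S A ν)
    {Pol : Finset (Policy S A ν)} {est : (↥Jᶜ → Obs S A) → Policy S A ν} (hest : IsMLE Pol est)
    {qalg : QuantileAlg S}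
    (hqalg : ∀ (m : ℕ) (α : ℝ), Measurable fun p : (Fin m → S × ℝ) × S => qalg m p.1 α p.2)
    (ε : ℝ) {δ : ℝ} (hδ : 0 ≤ δ) (εlo εup : ℝ) :
    MeasurableSet (calibratedSet PS πb PR J πe est qalg ε δ εlo εup) := by
  have : calibratedSet PS πb PR J πe est qalg ε δ εlo εup
      = ⋃ π : ↥Pol, ((fun d => fun i : ↥Jᶜ => d.1 i) ⁻¹' {d | est d = π}) ∩
        {d | (acceptedLaw PS πe πb PR π).real (Prod.mk d ⁻¹' missSet J πe est qalg ε δ εlo εup)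
          ≤ ε * (acceptedLaw PS πe πb PR π).real Set.univ} := by
    ext d
    simp only [Set.mem_iUnion, Set.mem_inter_iff, Set.mem_preimage, Set.mem_ofPred_eq,
      calibratedSet]
    constructor
    · exact fun h => ⟨⟨est fun i => d.1 i, hest.mem _⟩, rfl, h⟩
    · rintro ⟨π, h1, h2⟩
      rwa [h1]
  rw [this]
  refine MeasurableSet.iUnion fun π => MeasurableSet.inter ?_ (measurableSet_le ?_ measurable_const)
  · have hm : Measurable fun (d : (Fin n → Obs S A) × (Fin n → ℝ)) (i : ↥Jᶜ) =>
        d.1 (i : Fin n) := by fun_prop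
    exact hm (hest.measurable π π.2)
  · exact (measurable_measure_prodMk_left
      (measurableSet_missSet πe hest hqalg ε hδ εlo εup)).ennreal_toReal

/-- Given the first part of the data, calibration succeeds with probability at least `1 - δ`. -/
theorem ofReal_one_sub_le_measure_calibratedSet {Ω : Type*} [MeasurableSpace Ω] (P : Measure Ω)
    [IsProbabilityMeasure P] (πb : Policy S A ν) {J : Finset (Fin n)} (πe : Policy S A ν)
    {Pol : Finset (Policy S A ν)} {est : (↥Jᶜ → Obs S A) → Policy S A ν} (hest : IsMLE Pol est)
    {qalg : QuantileAlg S}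
    (hqalg : ∀ (m : ℕ) (α : ℝ), Measurable fun p : (Fin m → S × ℝ) × S => qalg m p.1 α p.2)
    {ε δ : ℝ} (hε0 : 0 < ε) (hε1 : ε < 1) (hδ : 0 ≤ δ) (εlo εup : ℝ)
    {Z : Fin n → Ω → Obs S A × ℝ} (hZ : ∀ i, Measurable (Z i))
    (hlaw : ∀ i, P.map (Z i)
      = (banditLaw PS πb PR).prod ((volume : Measure ℝ).restrict (Set.Icc 0 1)))
    (hind : iIndepFun Z P) (u : ↥Jᶜ → Obs S A × ℝ) :
    ENNReal.ofReal (1 - δ) ≤ P {ω |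
      ((fun i => (if h : i ∈ J then Z i ω else u ⟨i, Finset.mem_compl.2 h⟩).1),
        (fun i => (if h : i ∈ J then Z i ω else u ⟨i, Finset.mem_compl.2 h⟩).2)) ∈
          calibratedSet PS πb PR J πe est qalg ε δ εlo εup} := by
  classical
  -- The data with the first part frozen at $u$ and the second part random; the estimate, the
  -- accepted training set and the score become deterministic.
  set D : Ω → (Fin n → Obs S A) × (Fin n → ℝ) := fun ω =>
    ((fun i => (if h : i ∈ J then Z i ω else u ⟨i, Finset.mem_compl.2 h⟩).1),
      (fun i => (if h : i ∈ J then Z i ω else u ⟨i, Finset.mem_compl.2 h⟩).2)) with hD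
  have hDm : Measurable D := by
    refine (measurable_pi_lambda _ fun i => ?_).prodMk (measurable_pi_lambda _ fun i => ?_) <;>
    · by_cases h : i ∈ J
      · simp only [h, dite_true]; fun_prop
      · simp only [h, dite_false]; fun_prop
  have hout : ∀ ω (i : Fin n) (hi : i ∈ Jᶜ), ((D ω).1 i, (D ω).2 i) = u ⟨i, hi⟩ := by
    intro ω i hi
    simp [hD, Finset.mem_compl.1 hi]
  have hin : ∀ ω, ∀ i ∈ J, ((D ω).1 i, (D ω).2 i) = Z i ω := by
    intro ω i hi
    simp [hD, hi]
  set π := est fun i => (u i).1 with hπ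
  have hest' : ∀ ω, est (fun i => (D ω).1 i) = π := by
    intro ω
    rw [hπ]
    congr 1
    ext1 i
    exact congrArg Prod.fst (hout ω i i.2)
  obtain ⟨I₁, hI₁⟩ : ∃ I₁, ∀ ω, accepted (ratio πe π) Jᶜ (D ω).1 (D ω).2 = I₁ := by
    refine ⟨Finset.univ.filter fun i => ∃ h : i ∈ Jᶜ, u ⟨i, h⟩ ∈ acceptSet πe π, fun ω => ?_⟩
    ext i
    simp only [accepted_eq_filter, Finset.mem_filter, Finset.mem_univ, true_and]
    constructor
    · rintro ⟨hi, h⟩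
      exact ⟨hi, hout ω i hi ▸ h⟩
    · rintro ⟨hi, h⟩
      exact ⟨hi, (hout ω i hi).symm ▸ h⟩
  have hne : Nonempty Ω := P.nonempty_of_neZero
  have hpairs : ∀ ω ω', pairs I₁ (D ω).1 = pairs I₁ (D ω').1 := by
    intro ω ω'
    ext1 j
    have hsub : I₁ ⊆ Jᶜ := by
      rw [← hI₁ ω, accepted_eq_filter]
      exact Finset.filter_subset _ _
    have hmem : I₁.orderEmbOfFin rfl j ∈ Jᶜ := hsub (Finset.orderEmbOfFin_mem _ _ _)
    have := congrArg Prod.fst ((hout ω _ hmem).trans (hout ω' _ hmem).symm)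
    simp only at this
    simp only [pairs, this]
  -- The sample point is arbitrary, since only frozen coordinates enter.
  set t : Obs S A → ℝ := trainedScore qalg εlo εup I₁ (D hne.some).1 with ht
  have htD : ∀ ω, trainedScore qalg εlo εup I₁ (D ω).1 = t := by
    intro ω
    rw [ht]
    ext z
    unfold trainedScore
    rw [hpairs ω hne.some]
  have htm : Measurable t :=
    (measurable_trainedScore hqalg εlo εup I₁).comp measurable_prodMk_left
  have hmain := measureReal_calibration_fails_le PS PR P πe πb π J hZ hlaw hind htm hε0 hε1 hδ
  have hmiss : ∀ ω, Prod.mk (D ω) ⁻¹' missSet J πe est qalg ε δ εlo εup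
      = {z | ((J.filter fun i => Z i ω ∈ acceptSet πe π ∧ t z ≤ t (Z i ω).1).card : ℤ)
          ≤ kIndex (J.filter fun i => Z i ω ∈ acceptSet πe π).card ε δ} := by
    intro ω
    ext z
    have hacc : accepted (ratio πe π) J (D ω).1 (D ω).2
        = J.filter fun i => Z i ω ∈ acceptSet πe π := by
      rw [accepted_eq_filter]
      exact Finset.filter_congr fun i hi => by rw [hin ω i hi]
    refine (mem_missSet_iff (x := (D ω).1) (v := (D ω).2) hδ (hest' ω) (hI₁ ω) hacc).trans ?_
    rw [Finset.filter_filter, htD ω, Set.mem_ofPred_eq]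
    have : (J.filter fun i => Z i ω ∈ acceptSet πe π ∧ t z ≤ t ((D ω).1 i))
        = J.filter fun i => Z i ω ∈ acceptSet πe π ∧ t z ≤ t (Z i ω).1 :=
      Finset.filter_congr fun i hi => by rw [← hin ω i hi]
    rw [this]
  have hset : MeasurableSet (D ⁻¹' calibratedSet PS πb PR J πe est qalg ε δ εlo εup) :=
    hDm (measurableSet_calibratedSet PS PR πb πe hest hqalg ε hδ εlo εup)
  have hcompl : (D ⁻¹' calibratedSet PS πb PR J πe est qalg ε δ εlo εup)ᶜ
      = {ω | ε * (acceptedLaw PS πe πb PR π).real Set.univ < (acceptedLaw PS πe πb PR π).real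
        {z | ((J.filter fun i => Z i ω ∈ acceptSet πe π ∧ t z ≤ t (Z i ω).1).card : ℤ)
          ≤ kIndex (J.filter fun i => Z i ω ∈ acceptSet πe π).card ε δ}} := by
    ext ω
    simp only [Set.mem_compl_iff, Set.mem_preimage, calibratedSet, Set.mem_ofPred_eq, not_le,
      hest', hmiss]
  rw [← hcompl, probReal_compl_eq_one_sub hset] at hmain
  change _ ≤ P (D ⁻¹' calibratedSet PS πb PR J πe est qalg ε δ εlo εup)
  rw [← ofReal_measureReal]
  exact ENNReal.ofReal_le_ofReal (by linarith)

end Main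

/-- This identifies the size of the training part, the complement of $J$, with the floor in the
bound. -/
theorem floor_add_ceil (γ : ℝ) (h0 : 0 ≤ γ) (h1 : γ ≤ 1) (n : ℕ) :
    ⌊(1 - γ) * (n : ℝ)⌋₊ + ⌈γ * (n : ℝ)⌉₊ = n := by
  have hle : ⌈γ * (n : ℝ)⌉₊ ≤ n := Nat.ceil_le.2 (mul_le_of_le_one_left n.cast_nonneg h1)
  have : ⌊(1 - γ) * (n : ℝ)⌋₊ = n - ⌈γ * (n : ℝ)⌉₊ := by
    have h2 : 0 ≤ (1 - γ) * (n : ℝ) := mul_nonneg (by linarith) n.cast_nonneg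
    rw [Nat.floor_eq_iff h2, Nat.cast_sub hle]
    have h3 := Nat.le_ceil (γ * (n : ℝ))
    have h4 := Nat.ceil_lt_add_one (mul_nonneg h0 n.cast_nonneg : 0 ≤ γ * (n : ℝ))
    constructor <;> linarith
  omega

end PACOPP

theorem theorem6
    {Ω S A : Type*} [MeasurableSpace Ω] [MeasurableSpace S] [MeasurableSpace A]
    (P : Measure Ω) [IsProbabilityMeasure P]
    -- the bandit: context law, reward kernel, reference measure for the policy densities
    (PS : Measure S) [IsProbabilityMeasure PS]
    (PR : Kernel (S × A) ℝ) [IsMarkovKernel PR]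
    (ν : Measure A) [SigmaFinite ν]
    -- target policy, behavior policy, policy class
    (πe πb : PACOPP.Policy S A ν) (Pol : Finset (PACOPP.Policy S A ν)) (hπb : πb ∈ Pol)
    (BPol : ℝ≥0)
    (hB : ∀ π ∈ Pol, (⨆ (s : S) (a : A), PACOPP.ratio πe π s a) ≤ (BPol : ℝ≥0∞))
    -- parameters of the algorithm
    (ε δ γ εlo εup : ℝ) (hε : ε ∈ Set.Ioo (0 : ℝ) 1) (hδ : δ ∈ Set.Ioo (0 : ℝ) 1)
    (hγ : γ ∈ Set.Ioo (0 : ℝ) 1) (hq : εup - εlo = 1 - ε)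
    (n : ℕ) (hn : 0 < ⌊(1 - γ) * (n : ℝ)⌋₊)
    -- the split of the data
    (J : Finset (Fin n)) (hJ : J.card = ⌈γ * (n : ℝ)⌉₊)
    -- maximum likelihood estimation of the behavior policy; quantile algorithm
    (est : (↥Jᶜ → PACOPP.Obs S A) → PACOPP.Policy S A ν) (hest : PACOPP.IsMLE Pol est)
    (qalg : PACOPP.QuantileAlg S)
    (hqalg : ∀ (m : ℕ) (α : ℝ),
      Measurable fun p : (Fin m → S × ℝ) × S => qalg m p.1 α p.2)
    -- observations, uniform variables and test point
    (X : Fin n → Ω → PACOPP.Obs S A) (V : Fin n → Ω → ℝ) (T : Ω → PACOPP.Obs S A)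
    (hXm : ∀ i, Measurable (X i)) (hVm : ∀ i, Measurable (V i)) (hTm : Measurable T)
    (hXlaw : ∀ i, P.map (X i) = PACOPP.banditLaw PS πb PR)
    (hVlaw : ∀ i, P.map (V i) = (volume : Measure ℝ).restrict (Set.Icc 0 1))
    (hTlaw : P.map T = PACOPP.banditLaw PS πe PR)
    (hXindep : iIndepFun X P) (hVindep : iIndepFun V P)
    (hXV : IndepFun (fun ω i => X i ω) (fun ω i => V i ω) P)
    (hT : IndepFun T (fun ω => ((fun i => X i ω), (fun i => V i ω))) P)
    (δ₀ : ℝ) (hδ₀ : δ₀ ∈ Set.Ioo (0 : ℝ) 1) :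
    (1 - δ₀) * (1 - δ) ≤
      P.real {ω |
        PACOPP.miscoverage P (fun ω => ((fun i => X i ω), (fun i => V i ω))) T
            (fun ω => PACOPP.pacopp J πe est qalg ε δ εlo εup
              (fun i => X i ω) (fun i => V i ω)) ω
          ≤ ε + 2 * (BPol : ℝ) *
              √(2 * Real.log ((Pol.card : ℝ) / δ₀) / (⌊(1 - γ) * (n : ℝ)⌋₊ : ℝ))} := by
  classical
  set Z : Fin n → Ω → PACOPP.Obs S A × ℝ := fun i ω => (X i ω, V i ω) with hZdef
  set data : Ω → (Fin n → PACOPP.Obs S A) × (Fin n → ℝ) :=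
    fun ω => ((fun i => X i ω), (fun i => V i ω)) with hdata
  have hZ : ∀ i, Measurable (Z i) := fun i => (hXm i).prodMk (hVm i)
  have hdm : Measurable data :=
    (measurable_pi_lambda _ hXm).prodMk (measurable_pi_lambda _ hVm)
  have hZind : iIndepFun Z P := PACOPP.iIndepFun_prodMk hXm hVm hXindep hVindep hXV
  have hZlaw : ∀ i, P.map (Z i)
      = (PACOPP.banditLaw PS πb PR).prod ((volume : Measure ℝ).restrict (Set.Icc 0 1)) := by
    intro i
    rw [← hXlaw i, ← hVlaw i]
    exact (hXV.comp (measurable_pi_apply i) (measurable_pi_apply i)).map_prod_eq_prod_map_map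
      (hXm i).aemeasurable (hVm i).aemeasurable
  have hcard : Fintype.card ↥Jᶜ = ⌊(1 - γ) * (n : ℝ)⌋₊ := by
    have := PACOPP.floor_add_ceil γ hγ.1.le hγ.2.le n
    rw [Fintype.card_coe, Finset.card_compl, Fintype.card_fin, hJ]
    omega
  rw [← hcard] at hn ⊢
  set b : ℝ := √(2 * Real.log ((Pol.card : ℝ) / δ₀) / (Fintype.card ↥Jᶜ : ℝ)) with hb
  set C := PACOPP.calibratedSet PS πb PR J πe est qalg ε δ εlo εup
  set G₁ : Set (↥Jᶜ → PACOPP.Obs S A × ℝ) :=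
    {u | PACOPP.policyDist PS (est fun i => (u i).1) πb ≤ 2 * b} with hG₁
  -- The good event: an accurate estimate and successful calibration. Its first condition is `G₁`,
  -- which depends only on the coordinates outside $J$.
  set G₂ : Set (Fin n → PACOPP.Obs S A × ℝ) :=
    {y | PACOPP.policyDist PS (est fun i => (y i).1) πb ≤ 2 * b ∧
      ((fun i => (y i).1), (fun i => (y i).2)) ∈ C} with hG₂
  have hestm : MeasurableSet {x : ↥Jᶜ → PACOPP.Obs S A |
      PACOPP.policyDist PS (est x) πb ≤ 2 * b} := by
    have : {x : ↥Jᶜ → PACOPP.Obs S A | PACOPP.policyDist PS (est x) πb ≤ 2 * b}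
        = ⋃ π : ↥Pol, {x | est x = π} ∩ {_x | PACOPP.policyDist PS π.1 πb ≤ 2 * b} := by
      ext x
      simp only [Set.mem_iUnion, Set.mem_inter_iff, Set.mem_ofPred_eq]
      constructor
      · exact fun h => ⟨⟨est x, hest.mem x⟩, rfl, h⟩
      · rintro ⟨π, h1, h2⟩
        rwa [h1]
    rw [this]
    exact MeasurableSet.iUnion fun π => (hest.measurable π π.2).inter (MeasurableSet.const _)
  have hG₁m : MeasurableSet G₁ := by
    have hm : Measurable fun (u : ↥Jᶜ → PACOPP.Obs S A × ℝ) i => (u i).1 := by fun_prop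
    exact hm hestm
  have hG₂m : MeasurableSet G₂ := by
    have hm : Measurable fun (y : Fin n → PACOPP.Obs S A × ℝ) (i : ↥Jᶜ) => (y i).1 := by fun_prop
    have hm' : Measurable fun y : Fin n → PACOPP.Obs S A × ℝ =>
      ((fun i => (y i).1), (fun i => (y i).2)) := by fun_prop
    exact (hm hestm).inter
      (hm' (PACOPP.measurableSet_calibratedSet PS PR πb πe hest hqalg ε hδ.1.le εlo εup))
  have hprod := PACOPP.mul_le_measure_of_iIndepFun hZ hZind J hG₂m hG₁m
    (c := ENNReal.ofReal (1 - δ)) (by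
      intro u hu
      refine (PACOPP.ofReal_one_sub_le_measure_calibratedSet PS PR P πb πe hest hqalg hε.1 hε.2
        hδ.1.le εlo εup hZ hZlaw hZind u).trans (measure_mono fun ω hω => ⟨?_, hω⟩)
      have : (fun i : ↥Jᶜ => (if h : (i : Fin n) ∈ J then Z i ω
          else u ⟨i, Finset.mem_compl.2 h⟩).1) = fun i => (u i).1 := by
        ext1 i
        simp [Finset.mem_compl.1 i.2]
      rw [this]
      exact hu)
  have hmle : 1 - δ₀ ≤ P.real {ω | (fun i : ↥Jᶜ => Z i ω) ∈ G₁} := by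
    have h := PACOPP.measure_lt_policyDist_mle_le PS PR P Pol hπb hest (fun (i : ↥Jᶜ) => X i)
      (fun i => hXm i) (fun i => hXlaw i) (hXindep.precomp Subtype.val_injective) hn hδ₀
    have hmm : MeasurableSet {ω | (fun i : ↥Jᶜ => Z i ω) ∈ G₁} :=
      (measurable_pi_lambda (fun ω (i : ↥Jᶜ) => Z i ω) fun i => hZ i) hG₁m
    have hc : {ω | 2 * b < PACOPP.policyDist PS (est fun i => X i ω) πb}
        = {ω | (fun i : ↥Jᶜ => Z i ω) ∈ G₁}ᶜ := by
      ext ω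
      simp [hG₁, hZdef]
    rw [hc, probReal_compl_eq_one_sub hmm] at h
    linarith
  have hmiss := PACOPP.measurableSet_missSet (J := J) πe hest hqalg ε hδ.1.le εlo εup
  have hcond := PACOPP.condExp_indicator_eq_of_indepFun hdm hTm hT hmiss
  calc (1 - δ₀) * (1 - δ) ≤ P.real {ω | (fun i => Z i ω) ∈ G₂} := by
        have h1 := ENNReal.toReal_mono (measure_ne_top _ _) hprod
        rw [ENNReal.toReal_mul, ENNReal.toReal_ofReal (by linarith [hδ.2])] at h1
        refine le_trans ?_ h1
        rw [mul_comm]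
        exact mul_le_mul_of_nonneg_left hmle (by linarith [hδ.2])
    _ ≤ _ := by
        refine ENNReal.toReal_mono (measure_ne_top _ _) (measure_mono_ae ?_)
        filter_upwards [hcond] with ω hω hG
        change PACOPP.policyDist PS (est fun i => X i ω) πb ≤ 2 * b ∧ data ω ∈ C at hG
        -- On the good event the transfer bound applies with distance at most $2b$, which yields the
        -- constant $2B_\Pi$.
        have h2 := PACOPP.banditLaw_real_le PS PR πe πb (est fun i => X i ω)
          (hB _ (hest.mem _)) hε.1.le hε.2.le (measurable_prodMk_left hmiss) hG.2
        rw [← hTlaw, hω] at h2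
        refine h2.trans ?_
        have := mul_le_mul_of_nonneg_left hG.1 BPol.coe_nonneg
        linarith
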